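/- For integers $l>n\ge 1$ and complex numbers $x,y$ let $$S_{l,n}(x,y)=\sum_{\substack{l_1\ge 2,\ l_2,\dots,l_n\ge 1\\ l_1+\cdots+l_n=l}} x^{l_1-1}\,y^{\,l-l_1-(n-1)}\,\zeta(l_1,\dots,l_n),\qquad \zeta(l_1,\dots,l_n)=\sum_{m_1>\cdots>m_n>0}\frac{1}{m_1^{l_1}\cdots m_n^{l_n}},$$ with the convention $0^0=1$, so that $S_{l,1}(x,y)=x^{l-1}\zeta(l)$. Let $\Gamma$ be the gamma function, with $1/\Gamma$ read as an entire function. **Theorem.** Let $x,y,X,Y$ be complex numbers with $|xX|<1$, $|yX|<1$, $|Y|<1$. Then the double series below converges absolutely and $$\sum_{l>n\ge 1}\Bigl[S_{l,n}(x+y,y)+(-1)^nS_{l,n}(y+x,x)-\bigl((-1)^nx^{l-n}+y^{l-n}\bigr)\zeta(l)\Bigr]X^{l-n}Y^n =1-\frac{\Gamma(1-xX)\,\Gamma(1-Y)\,\Gamma(1-yX)\,\Gamma(1+Y)}{\Gamma(1-xX-Y)\,\Gamma(1-yX+Y)}.$$ If moreover $|xX+Y|<1$ and $|yX-Y|<1$,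 then the series over $m$ below converges absolutely and both sides are equal to $$1-\exp\left(\sum_{m=2}^{\infty}\zeta(m)\,\frac{(x^m+y^m)X^m+(1+(-1)^m)Y^m-(xX+Y)^m-(yX-Y)^m}{m}\right).$$ In particular, for fixed $x,y$ all these equalities hold for all $(X,Y)$ in a neighbourhood of $(0,0)$, hence as identities of power series in $X,Y$. -/

import Mathlib

/-- The multiple zeta value `ζ(l₁, …, lₙ) = ∑_{m₁ > ⋯ > mₙ > 0} 1 / (m₁ ^ l₁ ⋯ mₙ ^ lₙ)`
(entries are indexed from `0`); the series converges when all `lᵢ ≥ 1` and `l₁ ≥ 2`. -/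
noncomputable def multipleZeta {n : ℕ} (l : Fin n → ℕ) : ℝ :=
  ∑' m : {m : Fin n → ℕ // StrictAnti m ∧ ∀ i, 0 < m i}, 1 / ∏ i, (m.1 i : ℝ) ^ l i

/-- The multi-indices `(l₁, …, lₙ)` of depth `n = d + 1` and weight `l`
with `l₁ ≥ 2` and `l₂, …, lₙ ≥ 1`. -/
def admissibleIndices (l d : ℕ) : Finset (Fin (d + 1) → ℕ) :=
  (Finset.Nat.antidiagonalTuple (d + 1) l).filter fun k => 2 ≤ k 0 ∧ ∀ i, 1 ≤ k i

/-- The two-parameter weighted sum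
`S_{l,n}(x, y) = ∑ x ^ (l₁ - 1) * y ^ (l - l₁ - (n - 1)) * ζ(l₁, …, lₙ)` of the multiple zeta
values of weight `l` and depth `n` (with value `0` for the meaningless depth `n = 0`). -/
noncomputable def weightedSumMZV (l : ℕ) : ℕ → ℂ → ℂ → ℂ
  | 0, _, _ => 0
  | d + 1, x, y =>
    ∑ k ∈ admissibleIndices l d,
      x ^ (k 0 - 1) * y ^ (l - k 0 - d) * (multipleZeta k : ℂ)

/-! Put A = xX, B = yX and P_N(B, Y) = ∏_{j ≤ N} (1 + Y/(j - B)), which is `pochRatio`. Expanding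
P_N(B, Y) in powers of B and Y generates all truncated multiple zeta sums (`hasSum_truncSum_prod`).
Summing over the largest index m therefore turns the part of depth at least two of the first
weighted sum into a single series with terms (A + B)/(m(m - A - B)) · Y(P_{m-1}(B, Y) - 1), m ≥ 2
(`hasSum_weighted`); the second weighted sum is the same with A, B exchanged and Y negated. The
depth-one terms cancel. The values ζ(l) contribute BY ∑ 1/((j - B)(j - Y)) and its mirror image;
`hasSum_inv_mul_inv` rewrites this as BY ∑ P_{j-1}(B, Y)/(j(j - B)), a series of the same shape.
Partial fractions combine everything into 1 - `connSum A B Y 0` (`tsum_add_tsum_sub_eq`).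

The quantity `connSum A B Y N` consists of P_N(B, Y) P_N(A, -Y), with a rational correction, and of
two tails of series. It does not depend on N (`connSum_succ`), so it can be evaluated as N → ∞. The
tails need not vanish in the limit; instead the whole is compared with the case A = B = 0, where the
value is 1. Every ingredient is asymptotically R = `gammaRatio A (-Y) * gammaRatio B Y` times its
counterpart there (`tendsto_connSeries_sub`), so the constant value is R (`connSum_zero_eq`), the
quotient of Gamma values.

For the exponential form, the exponentials of the partial sums of the series for log Γ are exactly
the finite products that converge to R (`exp_logGammaSeries`). -/

open Filter Topology Finset

/-! ### The products `pochRatio`: limits and growth. -/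

/-- The product `∏_{1 ≤ j ≤ i} (1 + Y / (j - B))`. -/
noncomputable def pochRatio (B Y : ℂ) (i : ℕ) : ℂ :=
  ∏ j ∈ range i, (1 + Y / ((j : ℂ) + 1 - B))

/-- The limit of `pochRatio B Y i / pochRatio 0 Y i`. -/
noncomputable def gammaRatio (B Y : ℂ) : ℂ :=
  Complex.Gamma (1 - B) * Complex.Gamma (1 + Y) / Complex.Gamma (1 - B + Y)

@[simp] lemma pochRatio_zero (B Y : ℂ) : pochRatio B Y 0 = 1 := by simp [pochRatio]

lemma pochRatio_succ (B Y : ℂ) (i : ℕ) :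
    pochRatio B Y (i + 1) = pochRatio B Y i * (1 + Y / ((i : ℂ) + 1 - B)) := by
  simp [pochRatio, prod_range_succ]

lemma norm_natCast_add_one (j : ℕ) : ‖(j : ℂ) + 1‖ = (j : ℝ) + 1 := by
  have := Complex.norm_natCast (j + 1)
  push_cast at this
  exact this

lemma norm_natCast_add_one_sub_ge (B : ℂ) (j : ℕ) :
    (1 - ‖B‖) * ((j : ℝ) + 1) ≤ ‖(j : ℂ) + 1 - B‖ := by
  have h1 : ‖((j : ℂ) + 1)‖ - ‖B‖ ≤ ‖(j : ℂ) + 1 - B‖ := norm_sub_norm_le _ _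
  rw [norm_natCast_add_one] at h1
  nlinarith [norm_nonneg B, (Nat.cast_nonneg j : (0 : ℝ) ≤ j)]

lemma natCast_add_one_sub_ne_zero {B : ℂ} (hB : ‖B‖ < 1) (j : ℕ) : (j : ℂ) + 1 - B ≠ 0 := by
  have h := norm_natCast_add_one_sub_ge B j
  have : 0 < (1 - ‖B‖) * ((j : ℝ) + 1) := by
    have : (0 : ℝ) < 1 - ‖B‖ := by linarith
    positivity
  exact norm_pos_iff.1 (this.trans_le h)

lemma one_add_div_ne_zero {Y : ℂ} (hY : ‖Y‖ < 1) (j : ℕ) : 1 + Y / ((j : ℂ) + 1 - 0) ≠ 0 := by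
  have h1 : (j : ℂ) + 1 - -Y ≠ 0 := natCast_add_one_sub_ne_zero (by simpa using hY) j
  have h2 : (j : ℂ) + 1 ≠ 0 := Nat.cast_add_one_ne_zero j
  rw [sub_zero, one_add_div h2]
  exact div_ne_zero (by simpa using h1) h2

lemma pochRatio_zero_ne_zero {Y : ℂ} (hY : ‖Y‖ < 1) (i : ℕ) : pochRatio 0 Y i ≠ 0 :=
  prod_ne_zero_iff.2 fun j _ => one_add_div_ne_zero hY j

lemma pochRatio_eq_div {B : ℂ} (hB : ‖B‖ < 1) (Y : ℂ) (i : ℕ) :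
    pochRatio B Y i
      = (∏ j ∈ range i, (1 - B + Y + (j : ℂ))) / ∏ j ∈ range i, (1 - B + (j : ℂ)) := by
  rw [pochRatio, ← prod_div_distrib]
  refine prod_congr rfl fun j _ => ?_
  have h := natCast_add_one_sub_ne_zero hB j
  have h' : 1 - B + (j : ℂ) ≠ 0 := by convert h using 1; ring
  rw [one_add_div h]
  congr 1 <;> ring

/-- Euler's limit formula at four points: the powers of n cancel because (1 - B) + (1 + Y) = (1 - B
+ Y) + 1. -/
lemma tendsto_pochRatio_div {B : ℂ} (hB : ‖B‖ < 1) (Y : ℂ) :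
    Tendsto (fun i => pochRatio B Y i / pochRatio 0 Y i) atTop (𝓝 (gammaRatio B Y)) := by
  -- The shift matches `Complex.GammaSeq` at n, whose denominator has n + 1 factors.
  rw [← tendsto_add_atTop_iff_nat 1]
  -- At a pole `Complex.Gamma` has the default value 0, so `gammaRatio` is 0. This is the right
  -- limit: 1 - B + Y = -m makes a factor of the product vanish.
  by_cases hG : Complex.Gamma (1 - B + Y) = 0
  · obtain ⟨m, hm⟩ := (Complex.Gamma_eq_zero_iff _).1 hG
    have h0 : gammaRatio B Y = 0 := by simp [gammaRatio, hG]
    rw [h0]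
    refine tendsto_const_nhds.congr' ?_
    filter_upwards [eventually_ge_atTop m] with i hi
    rw [pochRatio_eq_div hB, prod_eq_zero (i := m) (by simp; omega) (by rw [hm]; ring)]
    simp
  · have h1 := Complex.GammaSeq_tendsto_Gamma (1 - B)
    have h2 := Complex.GammaSeq_tendsto_Gamma (1 + Y)
    have h3 := Complex.GammaSeq_tendsto_Gamma (1 - B + Y)
    have h4 := Complex.GammaSeq_tendsto_Gamma 1
    have h5 := (h1.mul h2).div (h3.mul h4) (by simpa using hG)
    have h6 : Complex.Gamma (1 - B) * Complex.Gamma (1 + Y)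
        / (Complex.Gamma (1 - B + Y) * Complex.Gamma 1) = gammaRatio B Y := by
      simp [gammaRatio]
    rw [h6] at h5
    refine h5.congr' ?_
    filter_upwards [eventually_ge_atTop 1] with n hn
    have hn0 : (n : ℂ) ≠ 0 := by exact_mod_cast (by omega : n ≠ 0)
    have hpow : (n : ℂ) ^ (1 - B) * (n : ℂ) ^ (1 + Y) = (n : ℂ) ^ (1 - B + Y) * (n : ℂ) ^ (1 : ℂ) := by
      rw [← Complex.cpow_add _ _ hn0, ← Complex.cpow_add _ _ hn0]
      congr 1; ring
    have hne : ∀ s : ℂ, (n : ℂ) ^ s ≠ 0 := fun s => by simp [Complex.cpow_eq_zero_iff, hn0]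
    have hf : ((n.factorial : ℕ) : ℂ) ≠ 0 := by exact_mod_cast n.factorial_ne_zero
    simp only [Pi.div_apply, Complex.GammaSeq]
    rw [pochRatio_eq_div hB, pochRatio_eq_div (by simp : ‖(0 : ℂ)‖ < 1)]
    have e1 : (1 : ℂ) - 0 + Y = 1 + Y := by ring
    have e2 : (1 : ℂ) - 0 = 1 := by ring
    rw [e1, e2]
    set a := ∏ j ∈ range (n + 1), (1 - B + Y + (j : ℂ))
    set b := ∏ j ∈ range (n + 1), (1 - B + (j : ℂ))
    set c := ∏ j ∈ range (n + 1), (1 + Y + (j : ℂ))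
    set d := ∏ j ∈ range (n + 1), (1 + (j : ℂ))
    have key : (n : ℂ) ^ (1 - B) * n.factorial / b * ((n : ℂ) ^ (1 + Y) * n.factorial / c)
        / ((n : ℂ) ^ (1 - B + Y) * n.factorial / a * ((n : ℂ) ^ (1 : ℂ) * n.factorial / d))
        = (((n : ℂ) ^ (1 - B) * (n : ℂ) ^ (1 + Y)) / ((n : ℂ) ^ (1 - B + Y) * (n : ℂ) ^ (1 : ℂ)))
          * (((n.factorial : ℂ) * n.factorial) / ((n.factorial : ℂ) * n.factorial))
          * (a / b / (c / d)) := by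
      simp only [div_eq_mul_inv, mul_inv, inv_inv]; ring
    rw [key, hpow, div_self (mul_ne_zero (hne _) (hne _)), div_self (mul_ne_zero hf hf)]
    ring

lemma norm_pochRatio_zero_le (Y : ℂ) (i : ℕ) :
    ‖pochRatio 0 Y i‖ ≤ Real.exp ‖Y‖ * ((i : ℝ) + 1) ^ ‖Y‖ := by
  have h1 : ‖pochRatio 0 Y i‖ ≤ Real.exp (‖Y‖ * (harmonic i : ℝ)) := by
    rw [pochRatio, norm_prod, harmonic]
    push_cast
    rw [mul_sum, Real.exp_sum]
    refine prod_le_prod (fun _ _ => norm_nonneg _) fun j _ => ?_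
    calc ‖1 + Y / ((j : ℂ) + 1 - 0)‖ ≤ ‖(1 : ℂ)‖ + ‖Y / ((j : ℂ) + 1 - 0)‖ := norm_add_le _ _
      _ = ‖Y‖ * ((j : ℝ) + 1)⁻¹ + 1 := by
        rw [sub_zero, norm_div, norm_natCast_add_one, norm_one]; ring
      _ ≤ _ := Real.add_one_le_exp _
  refine h1.trans ?_
  have h2 : Real.log i ≤ Real.log ((i : ℝ) + 1) := by
    rcases Nat.eq_zero_or_pos i with rfl | hi
    · simp
    · exact Real.log_le_log (by exact_mod_cast hi) (by linarith)
  have h3 := harmonic_le_one_add_log i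
  have hp : (0 : ℝ) < (i : ℝ) + 1 := by positivity
  rw [Real.rpow_def_of_pos hp, ← Real.exp_add]
  refine Real.exp_le_exp.2 ?_
  nlinarith [norm_nonneg Y]

lemma exists_norm_pochRatio_div_le {B Y : ℂ} (hB : ‖B‖ < 1) :
    ∃ C, 0 ≤ C ∧ ∀ i, ‖pochRatio B Y i / pochRatio 0 Y i‖ ≤ C := by
  obtain ⟨C, hC⟩ := (Metric.isBounded_range_of_tendsto _
    (tendsto_pochRatio_div hB Y)).exists_norm_le
  have := fun i => hC _ (Set.mem_range_self i)
  exact ⟨C, (norm_nonneg _).trans (this 0), this⟩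

/-- The exponent ‖Y‖ < 1 is what makes all later series with quadratic denominators converge
absolutely. -/
lemma exists_norm_pochRatio_le {B Y : ℂ} (hB : ‖B‖ < 1) (hY : ‖Y‖ < 1) :
    ∃ C, 0 ≤ C ∧ ∀ i : ℕ, ‖pochRatio B Y i‖ ≤ C * ((i : ℝ) + 1) ^ ‖Y‖ := by
  obtain ⟨C, hC0, hC⟩ := exists_norm_pochRatio_div_le (Y := Y) hB
  refine ⟨C * Real.exp ‖Y‖, by positivity, fun i => ?_⟩
  have h := mul_le_mul (hC i) (norm_pochRatio_zero_le Y i) (norm_nonneg _) hC0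
  rw [← norm_mul, div_mul_cancel₀ _ (pochRatio_zero_ne_zero hY i)] at h
  linarith

lemma summable_rpow_div_sq {σ : ℝ} (hσ : σ < 1) :
    Summable fun i : ℕ => ((i : ℝ) + 1) ^ σ / ((i : ℝ) + 1) ^ 2 := by
  have h := (summable_nat_add_iff 1).2
    (Real.summable_one_div_nat_rpow.2 (by linarith : 1 < 2 - σ))
  refine h.congr fun i => ?_
  have hp : (0 : ℝ) < (i : ℝ) + 1 := by positivity
  push_cast
  rw [Real.rpow_sub hp, one_div_div, Real.rpow_two]

lemma tendsto_natCast_rpow_div {σ : ℝ} (hσ : σ < 1) :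
    Tendsto (fun i : ℕ => ((i : ℝ) + 1) ^ σ / ((i : ℝ) + 1)) atTop (𝓝 0) := by
  have h := (tendsto_rpow_neg_atTop (by linarith : 0 < 1 - σ)).comp
    (tendsto_natCast_atTop_atTop.comp (tendsto_add_atTop_nat 1))
  refine h.congr fun i => ?_
  have hp : (0 : ℝ) < (i : ℝ) + 1 := by positivity
  simp only [Function.comp]
  push_cast
  rw [neg_sub, Real.rpow_sub hp, Real.rpow_one]

/-- A series whose terms are `pochRatio` divided by something of quadratic growth. -/
lemma summable_norm_pochRatio_mul {B Y : ℂ} (hB : ‖B‖ < 1) (hY : ‖Y‖ < 1) {f : ℕ → ℂ} {K : ℝ}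
    (hf : ∀ i : ℕ, ‖f i‖ ≤ K / ((i : ℝ) + 1) ^ 2) :
    Summable fun i => ‖pochRatio B Y i * f i‖ := by
  obtain ⟨C, hC0, hC⟩ := exists_norm_pochRatio_le hB hY
  refine Summable.of_nonneg_of_le (fun _ => norm_nonneg _) (fun i => ?_)
    ((summable_rpow_div_sq hY).mul_left (C * K))
  rw [norm_mul]
  calc _ ≤ (C * ((i : ℝ) + 1) ^ ‖Y‖) * (K / ((i : ℝ) + 1) ^ 2) :=
        mul_le_mul (hC i) (hf i) (norm_nonneg _) (by positivity)
    _ = _ := by ring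

lemma tendsto_pochRatio_mul {B Y : ℂ} (hB : ‖B‖ < 1) (hY : ‖Y‖ < 1) {f : ℕ → ℂ} {K : ℝ}
    (hf : ∀ i : ℕ, ‖f i‖ ≤ K / ((i : ℝ) + 1)) :
    Tendsto (fun i => pochRatio B Y i * f i) atTop (𝓝 0) := by
  obtain ⟨C, hC0, hC⟩ := exists_norm_pochRatio_le hB hY
  have h := (tendsto_natCast_rpow_div hY).const_mul (C * K)
  rw [mul_zero] at h
  refine squeeze_zero_norm (fun i => ?_) h
  rw [norm_mul]
  calc _ ≤ (C * ((i : ℝ) + 1) ^ ‖Y‖) * (K / ((i : ℝ) + 1)) :=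
        mul_le_mul (hC i) (hf i) (norm_nonneg _) (by positivity)
    _ = _ := by ring

lemma norm_inv_natCast_add_one_sub_le {B : ℂ} (hB : ‖B‖ < 1) (j : ℕ) :
    ‖((j : ℂ) + 1 - B)⁻¹‖ ≤ (1 - ‖B‖)⁻¹ / ((j : ℝ) + 1) := by
  have h : (0 : ℝ) < 1 - ‖B‖ := by linarith
  rw [norm_inv, div_eq_mul_inv, ← mul_inv]
  exact inv_anti₀ (by positivity) (norm_natCast_add_one_sub_ge B j)

lemma hasSum_telescope {f : ℕ → ℂ} {g : ℕ → ℂ} (hf : Summable f) (hg : Tendsto g atTop (𝓝 0))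
    (h : ∀ i, f i = g i - g (i + 1)) : HasSum f (g 0) := by
  have h1 := hf.hasSum.tendsto_sum_nat
  have h2 : Tendsto (fun n => ∑ i ∈ range n, f i) atTop (𝓝 (g 0 - 0)) := by
    simp_rw [h, sum_range_sub']
    exact tendsto_const_nhds.sub hg
  rw [sub_zero] at h2
  rw [← tendsto_nhds_unique h1 h2]
  exact hf.hasSum

/-! ### Transformation of the series ∑ 1/((j - B)(j - Y)). -/

/-- The numerators j - B + Y only see Y - B, so the simultaneous shift moves only the denominators,
whose quotient telescopes. -/
lemma pochRatio_sub_one {B : ℂ} (hB : ∀ j : ℕ, (j : ℂ) + 1 - B ≠ 0) (Y : ℂ) (i : ℕ) :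
    pochRatio (B - 1) (Y - 1) i = pochRatio B Y i * ((1 - B) / ((i : ℂ) + 1 - B)) := by
  induction i with
  | zero =>
    have := hB 0
    simp only [Nat.cast_zero, zero_add] at this
    simp [div_self this]
  | succ i ih =>
    have h1 := hB i
    have h2 := hB (i + 1)
    push_cast at h2
    have h3 : (i : ℂ) + 1 - (B - 1) ≠ 0 := by convert h2 using 1; ring
    rw [pochRatio_succ, pochRatio_succ, ih, one_add_div h3, one_add_div h1]
    push_cast
    rw [mul_assoc, mul_assoc]
    congr 1
    field_simp
    ring

lemma norm_le_norm_add_natCast {z : ℂ} (hz : 0 ≤ z.re) (N : ℕ) : ‖z‖ ≤ ‖z + N‖ := by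
  rw [← sq_le_sq₀ (norm_nonneg _) (norm_nonneg _), Complex.sq_norm, Complex.sq_norm,
    Complex.normSq_apply, Complex.normSq_apply]
  simp only [Complex.add_re, Complex.natCast_re, Complex.add_im, Complex.natCast_im, add_zero]
  have : (0 : ℝ) ≤ N := N.cast_nonneg
  nlinarith [mul_nonneg this hz]

lemma norm_add_one_sub_le_shift {B : ℂ} (hB : ‖B‖ < 1) (N i : ℕ) :
    ‖(i : ℂ) + 1 - B‖ ≤ ‖(i : ℂ) + 1 - (B - N)‖ := by
  have h : (0 : ℝ) ≤ ((i : ℂ) + 1 - B).re := by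
    simp only [Complex.sub_re, Complex.add_re, Complex.natCast_re, Complex.one_re]
    have := (Complex.re_le_norm B).trans hB.le
    have : (0 : ℝ) ≤ i := i.cast_nonneg
    linarith
  convert norm_le_norm_add_natCast h N using 2
  ring

lemma add_one_sub_shift_ne_zero {B : ℂ} (hB : ‖B‖ < 1) (N i : ℕ) :
    (i : ℂ) + 1 - (B - N) ≠ 0 :=
  norm_pos_iff.1 ((norm_pos_iff.2 (natCast_add_one_sub_ne_zero hB i)).trans_le
    (norm_add_one_sub_le_shift hB N i))

/-- The numerators are unchanged, and adding N ≥ 0 to a denominator with positive real part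
increases its norm. -/
lemma norm_pochRatio_shift_le {B : ℂ} (hB : ‖B‖ < 1) (Y : ℂ) (N i : ℕ) :
    ‖pochRatio (B - N) (Y - N) i‖ ≤ ‖pochRatio B Y i‖ := by
  rw [pochRatio, pochRatio, norm_prod, norm_prod]
  refine prod_le_prod (fun _ _ => norm_nonneg _) fun j _ => ?_
  rw [one_add_div (natCast_add_one_sub_ne_zero hB j), one_add_div (add_one_sub_shift_ne_zero hB N j),
    norm_div, norm_div]
  have e : (j : ℂ) + 1 - (B - N) + (Y - N) = j + 1 - B + Y := by ring
  rw [e]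
  exact div_le_div_of_nonneg_left (norm_nonneg _)
    (norm_pos_iff.2 (natCast_add_one_sub_ne_zero hB j)) (norm_add_one_sub_le_shift hB N j)

lemma norm_inv_add_one_sub_shift_le {B : ℂ} (hB : ‖B‖ < 1) (N i : ℕ) :
    ‖((i : ℂ) + 1 - (B - N))⁻¹‖ ≤ (1 - ‖B‖)⁻¹ / ((i : ℝ) + 1) := by
  refine le_trans ?_ (norm_inv_natCast_add_one_sub_le hB i)
  rw [norm_inv, norm_inv]
  exact inv_anti₀ (norm_pos_iff.2 (natCast_add_one_sub_ne_zero hB i))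
    (norm_add_one_sub_le_shift hB N i)

lemma norm_inv_natCast_add_one (i : ℕ) : ‖((i : ℂ) + 1)⁻¹‖ = 1 / ((i : ℝ) + 1) := by
  rw [norm_inv, norm_natCast_add_one, one_div]

lemma norm_inv_mul_inv_le {z w : ℂ} {C D : ℝ} {i : ℕ} (hz : ‖z⁻¹‖ ≤ C / ((i : ℝ) + 1))
    (hw : ‖w⁻¹‖ ≤ D / ((i : ℝ) + 1)) : ‖(z * w)⁻¹‖ ≤ C * D / ((i : ℝ) + 1) ^ 2 := by
  rw [mul_inv, norm_mul, sq, ← div_mul_div_comm]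
  exact mul_le_mul hz hw (norm_nonneg _) ((norm_nonneg _).trans hz)

lemma summable_pochRatio_shift_mul {B Y : ℂ} (hB : ‖B‖ < 1) (hY : ‖Y‖ < 1) (N : ℕ) {f : ℕ → ℂ}
    {K : ℝ} (hf : ∀ i : ℕ, ‖f i‖ ≤ K / ((i : ℝ) + 1) ^ 2) :
    Summable fun i => pochRatio (B - N) (Y - N) i * f i := by
  refine Summable.of_norm_bounded (summable_norm_pochRatio_mul hB hY hf) fun i => ?_
  rw [norm_mul, norm_mul]
  exact mul_le_mul_of_nonneg_right (norm_pochRatio_shift_le hB Y N i) (norm_nonneg _)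

/-- The series obtained by shifting both parameters, which interpolates between the two sides
of `hasSum_inv_mul_inv`. -/
noncomputable def shiftedSeries (B Y : ℂ) (N : ℕ) : ℂ :=
  ∑' i : ℕ, pochRatio (B - N) (Y - N) i * (((i : ℂ) + 1) * ((i : ℂ) + 1 - (B - N)))⁻¹

lemma shiftedSeries_sub_succ {B Y : ℂ} (hB : ‖B‖ < 1) (hY : ‖Y‖ < 1) (N : ℕ) :
    shiftedSeries B Y N - shiftedSeries B Y (N + 1)
      = (((N : ℂ) + 1 - B) * ((N : ℂ) + 1 - Y))⁻¹ := by
  have hs : ∀ N : ℕ, Summable fun i : ℕ => pochRatio (B - N) (Y - N) i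
      * (((i : ℂ) + 1) * ((i : ℂ) + 1 - (B - N)))⁻¹ := fun N =>
    summable_pochRatio_shift_mul hB hY N fun i =>
      norm_inv_mul_inv_le (norm_inv_natCast_add_one i).le (norm_inv_add_one_sub_shift_le hB N i)
  rw [shiftedSeries, shiftedSeries, ← (hs N).tsum_sub (hs (N + 1))]
  have hY1 := natCast_add_one_sub_ne_zero hY N
  -- The telescoping certificate: the termwise difference of the two series is g i - g (i + 1) for
  -- this g, and g 0 is the claimed value.
  have hg : Tendsto (fun i : ℕ => pochRatio (B - N) (Y - N) i
      * (((i : ℂ) + 1 - (B - N))⁻¹ * ((N : ℂ) + 1 - Y)⁻¹)) atTop (𝓝 0) := by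
    have h := tendsto_pochRatio_mul hB hY (f := fun i : ℕ => ((i : ℂ) + 1 - (B - N))⁻¹ * ((N : ℂ) + 1 - Y)⁻¹)
      (K := (1 - ‖B‖)⁻¹ * ‖((N : ℂ) + 1 - Y)⁻¹‖) fun i => by
        rw [norm_mul, mul_div_right_comm]
        exact mul_le_mul_of_nonneg_right (norm_inv_add_one_sub_shift_le hB N i) (norm_nonneg _)
    have h' := h.norm
    rw [norm_zero] at h'
    refine squeeze_zero_norm (fun i => ?_) h'
    rw [norm_mul, norm_mul (pochRatio B Y i)]
    exact mul_le_mul_of_nonneg_right (norm_pochRatio_shift_le hB Y N i) (norm_nonneg _)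
  have h := (hasSum_telescope ((hs N).sub (hs (N + 1))) hg fun i => ?_).tsum_eq
  · rw [h]
    simp only [pochRatio_zero, Nat.cast_zero, zero_add, one_mul, mul_inv]
    congr 2; ring
  · have h1 : ((N + 1 : ℕ) : ℂ) = N + 1 := by push_cast; ring
    have e1 : B - ((N : ℂ) + 1) = (B - N) - 1 := by ring
    have e2 : Y - ((N : ℂ) + 1) = (Y - N) - 1 := by ring
    have n1 := add_one_sub_shift_ne_zero hB N i
    have n2 := add_one_sub_shift_ne_zero hB N (i + 1)
    have n3 : (i : ℂ) + 1 ≠ 0 := Nat.cast_add_one_ne_zero i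
    rw [h1, e1, e2, pochRatio_sub_one (add_one_sub_shift_ne_zero hB N), pochRatio_succ, one_add_div n1]
    push_cast at n2 ⊢
    have n4 : (i : ℂ) + 1 - (B - N - 1) ≠ 0 := by convert n2 using 1; ring
    have e3 : (N : ℂ) + 1 - Y = 1 - (Y - N) := by ring
    rw [e3] at hY1 ⊢
    generalize Y - (N : ℂ) = Y at *
    generalize B - (N : ℂ) = B at *
    generalize pochRatio B Y i = p at *
    generalize (i : ℂ) = k at *
    have e4 : k + 1 - (B - 1) = k + 1 + 1 - B := by ring
    rw [e4]
    field_simp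
    ring

/-- Dominated convergence: the series for N = 0 is a majorant, and each fixed term dies because of
its factor 1/(i + 1 - B + N). -/
lemma tendsto_shiftedSeries {B Y : ℂ} (hB : ‖B‖ < 1) (hY : ‖Y‖ < 1) :
    Tendsto (shiftedSeries B Y) atTop (𝓝 0) := by
  have hf : ∀ i : ℕ, ‖(((i : ℂ) + 1) * ((i : ℂ) + 1 - B))⁻¹‖ ≤ 1 * (1 - ‖B‖)⁻¹ / ((i : ℝ) + 1) ^ 2 :=
    fun i => norm_inv_mul_inv_le (norm_inv_natCast_add_one i).le (norm_inv_natCast_add_one_sub_le hB i)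
  have hb : ∀ N i : ℕ, ‖pochRatio (B - N) (Y - N) i * (((i : ℂ) + 1) * ((i : ℂ) + 1 - (B - N)))⁻¹‖
      ≤ ‖pochRatio B Y i * (((i : ℂ) + 1) * ((i : ℂ) + 1 - B))⁻¹‖ := fun N i => by
    rw [norm_mul, norm_mul (pochRatio B Y i), mul_inv, mul_inv, norm_mul, norm_mul, norm_inv (_ - _),
      norm_inv ((i : ℂ) + 1 - B)]
    gcongr
    · exact norm_pochRatio_shift_le hB Y N i
    · exact norm_pos_iff.2 (natCast_add_one_sub_ne_zero hB i)
    · exact norm_add_one_sub_le_shift hB N i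
  have := tendsto_tsum_of_dominated_convergence (𝓕 := atTop) (g := fun _ : ℕ => (0 : ℂ))
    (summable_norm_pochRatio_mul hB hY hf) (fun i => ?_) (Eventually.of_forall hb)
  · rw [tsum_zero] at this
    exact this
  · have h1 : Tendsto (fun N : ℕ => ‖((N : ℂ) + ((i : ℂ) + 1 - B))⁻¹‖) atTop (𝓝 0) := by
      simp_rw [norm_inv]
      refine tendsto_inv_atTop_zero.comp (tendsto_atTop_mono (f := fun N : ℕ =>
        (N : ℝ) + -‖(i : ℂ) + 1 - B‖) (fun N => ?_)
        (tendsto_atTop_add_const_right _ _ tendsto_natCast_atTop_atTop))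
      have := norm_sub_norm_le (N : ℂ) (-((i : ℂ) + 1 - B))
      rw [norm_neg, sub_neg_eq_add, Complex.norm_natCast] at this
      linarith
    have h2 := h1.const_mul (‖pochRatio B Y i‖ * ‖((i : ℂ) + 1)⁻¹‖)
    rw [mul_zero] at h2
    refine squeeze_zero_norm (fun N => ?_) h2
    rw [norm_mul, mul_inv, norm_mul, ← mul_assoc]
    have e : (N : ℂ) + ((i : ℂ) + 1 - B) = (i : ℂ) + 1 - (B - N) := by ring
    rw [e]
    gcongr
    exact norm_pochRatio_shift_le hB Y N i

/-- An analogue of the sum formula for multiple zeta values. -/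
lemma hasSum_inv_mul_inv {B Y : ℂ} (hB : ‖B‖ < 1) (hY : ‖Y‖ < 1) :
    HasSum (fun i : ℕ => (((i : ℂ) + 1 - B) * ((i : ℂ) + 1 - Y))⁻¹)
      (∑' i : ℕ, pochRatio B Y i * (((i : ℂ) + 1) * ((i : ℂ) + 1 - B))⁻¹) := by
  have hs : Summable (fun i : ℕ => (((i : ℂ) + 1 - B) * ((i : ℂ) + 1 - Y))⁻¹) := by
    -- `pochRatio 0 0` is identically 1, so this is plain comparison with 1/(i + 1)².
    have := summable_norm_pochRatio_mul (B := 0) (Y := 0) (by simp) (by simp)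
      (f := fun i : ℕ => (((i : ℂ) + 1 - B) * ((i : ℂ) + 1 - Y))⁻¹) fun i =>
        norm_inv_mul_inv_le (norm_inv_natCast_add_one_sub_le hB i) (norm_inv_natCast_add_one_sub_le hY i)
    exact (summable_norm_iff.1 this).congr fun i => by simp [pochRatio]
  convert hasSum_telescope hs (tendsto_shiftedSeries hB hY)
    fun i => (shiftedSeries_sub_succ hB hY i).symm using 1
  simp [shiftedSeries]

/-! ### The connected sum and its independence of N. -/

lemma add_two_add_sub_bound {A B : ℂ} (hB : ‖B‖ < 1) (N i : ℕ) :
    (1 - ‖A‖) * ((i : ℝ) + 1) ≤ ‖(i : ℂ) + 2 + N - A - B‖ := by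
  have h1 := norm_sub_norm_le (((i + N + 1 : ℕ) : ℂ) + 1) (A + B)
  rw [norm_natCast_add_one] at h1
  have h2 := norm_add_le A B
  have h3 : ((i + N + 1 : ℕ) : ℂ) + 1 - (A + B) = (i : ℂ) + 2 + N - A - B := by push_cast; ring
  rw [h3] at h1
  push_cast at h1
  nlinarith [norm_nonneg A, norm_nonneg B, (Nat.cast_nonneg i : (0 : ℝ) ≤ i),
    (Nat.cast_nonneg N : (0 : ℝ) ≤ N)]

lemma add_two_add_sub_ne_zero {A B : ℂ} (hA : ‖A‖ < 1) (hB : ‖B‖ < 1) (N i : ℕ) :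
    (i : ℂ) + 2 + N - A - B ≠ 0 := by
  have : 0 < (1 - ‖A‖) * ((i : ℝ) + 1) := by
    have : (0 : ℝ) < 1 - ‖A‖ := by linarith
    positivity
  exact norm_pos_iff.1 (this.trans_le (add_two_add_sub_bound hB N i))

lemma norm_inv_add_two_add_sub_le {A B : ℂ} (hA : ‖A‖ < 1) (hB : ‖B‖ < 1) (N i : ℕ) :
    ‖((i : ℂ) + 2 + N - A - B)⁻¹‖ ≤ (1 - ‖A‖)⁻¹ / ((i : ℝ) + 1) := by
  have h : (0 : ℝ) < 1 - ‖A‖ := by linarith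
  rw [norm_inv, div_eq_mul_inv, ← mul_inv]
  exact inv_anti₀ (by positivity) (add_two_add_sub_bound hB N i)

lemma add_two_sub_ne_zero {B : ℂ} (hB : ‖B‖ < 1) (i : ℕ) : (i : ℂ) + 2 - B ≠ 0 := by
  simpa using add_two_add_sub_ne_zero (A := 0) (by simp) hB 0 i

lemma norm_inv_add_two_sub_le {B : ℂ} (hB : ‖B‖ < 1) (i : ℕ) :
    ‖((i : ℂ) + 2 - B)⁻¹‖ ≤ 1 / ((i : ℝ) + 1) := by
  simpa using norm_inv_add_two_add_sub_le (A := 0) (by simp) hB 0 i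

lemma tendsto_pochRatio_succ_mul {B Y : ℂ} (hB : ‖B‖ < 1) (hY : ‖Y‖ < 1) {f : ℕ → ℂ} {K : ℝ}
    (hf : ∀ i : ℕ, ‖f i‖ ≤ K / ((i : ℝ) + 1)) :
    Tendsto (fun i => pochRatio B Y (i + 1) * f i) atTop (𝓝 0) := by
  have h1 := tendsto_pochRatio_mul hB hY hf
  have h2 := tendsto_pochRatio_mul hB hY (f := fun i => (Y / ((i : ℂ) + 1 - B)) * f i)
    (K := ‖Y‖ * (1 - ‖B‖)⁻¹ * K) fun i => by
      have hK := (norm_nonneg _).trans (hf i)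
      have := norm_inv_natCast_add_one_sub_le hB i
      have h0 : (0 : ℝ) < 1 - ‖B‖ := by linarith
      have h3 : (1 - ‖B‖)⁻¹ / ((i : ℝ) + 1) ≤ (1 - ‖B‖)⁻¹ :=
        div_le_self (by positivity) (by linarith [(Nat.cast_nonneg i : (0 : ℝ) ≤ i)])
      rw [norm_mul, mul_div_assoc, div_eq_mul_inv, norm_mul]
      gcongr
      · exact this.trans h3
      · exact hf i
  simpa [pochRatio_succ, mul_add, add_mul, mul_assoc] using h1.add h2

lemma summable_norm_pochRatio_succ_mul {B Y : ℂ} (hB : ‖B‖ < 1) (hY : ‖Y‖ < 1) {f : ℕ → ℂ} {K : ℝ}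
    (hf : ∀ i : ℕ, ‖f i‖ ≤ K / ((i : ℝ) + 1) ^ 2) :
    Summable fun i => ‖pochRatio B Y (i + 1) * f i‖ := by
  have h0 : (0 : ℝ) < 1 - ‖B‖ := by linarith
  have hs := summable_norm_pochRatio_mul hB hY hf
  refine Summable.of_nonneg_of_le (fun _ => norm_nonneg _) (fun i => ?_)
    (hs.mul_left (1 + ‖Y‖ * (1 - ‖B‖)⁻¹))
  have := norm_inv_natCast_add_one_sub_le hB i
  have h3 : (1 - ‖B‖)⁻¹ / ((i : ℝ) + 1) ≤ (1 - ‖B‖)⁻¹ :=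
    div_le_self (by positivity) (by linarith [(Nat.cast_nonneg i : (0 : ℝ) ≤ i)])
  have h4 : ‖1 + Y / ((i : ℂ) + 1 - B)‖ ≤ 1 + ‖Y‖ * (1 - ‖B‖)⁻¹ := by
    refine (norm_add_le _ _).trans ?_
    rw [norm_one, div_eq_mul_inv, norm_mul]
    gcongr
    exact this.trans h3
  rw [pochRatio_succ, mul_right_comm, norm_mul, mul_comm]
  exact mul_le_mul_of_nonneg_right h4 (norm_nonneg _)

/-- The general term of the connecting series. -/
noncomputable def connTerm (A B Y : ℂ) (N i : ℕ) : ℂ :=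
  pochRatio B Y (i + 1) * ((A - N) * (((i : ℂ) + 2 + N - A - B) * ((i : ℂ) + 2 - B))⁻¹)

/-- The connecting series, a tail with parameter `N`. -/
noncomputable def connSeries (A B Y : ℂ) (N : ℕ) : ℂ :=
  pochRatio A (-Y) N * ∑' n : ℕ, connTerm A B Y N (n + N)

lemma summable_connTerm {A B Y : ℂ} (hA : ‖A‖ < 1) (hB : ‖B‖ < 1) (hY : ‖Y‖ < 1) (N : ℕ) :
    Summable (connTerm A B Y N) := by
  refine summable_norm_iff.1 (summable_norm_pochRatio_succ_mul hB hY
    (K := ‖A - N‖ * ((1 - ‖A‖)⁻¹ * 1)) fun i => ?_)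
  rw [norm_mul, mul_div_assoc]
  exact mul_le_mul_of_nonneg_left (norm_inv_mul_inv_le (norm_inv_add_two_add_sub_le hA hB N i)
    (norm_inv_add_two_sub_le hB i)) (norm_nonneg _)

/-- Passing from N to N + 1 loses the term i = N; on the common range i ≥ N + 1 the difference
telescopes and leaves one boundary term. -/
lemma connSeries_sub_succ {A B Y : ℂ} (hA : ‖A‖ < 1) (hB : ‖B‖ < 1) (hY : ‖Y‖ < 1) (N : ℕ) :
    connSeries A B Y N - connSeries A B Y (N + 1)
      = pochRatio A (-Y) N * (connTerm A B Y N N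
          + pochRatio B Y (N + 2) * (((N : ℂ) + 1 + 2 + N - A - B))⁻¹) := by
  have hs := summable_connTerm (Y := Y) hA hB hY
  have hA1 := natCast_add_one_sub_ne_zero hA N
  rw [connSeries, connSeries, pochRatio_succ, mul_assoc, ← mul_sub]
  congr 1
  have h0 : ∑' n : ℕ, connTerm A B Y N (n + N)
      = connTerm A B Y N N + ∑' n : ℕ, connTerm A B Y N (n + (N + 1)) := by
    rw [((summable_nat_add_iff N).2 (hs N)).tsum_eq_zero_add, zero_add]
    simp only [add_assoc, add_comm 1]
  rw [h0, add_sub_assoc]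
  congr 1
  have hs1 := (summable_nat_add_iff (N + 1)).2 (hs N)
  have hs2 := ((summable_nat_add_iff (N + 1)).2 (hs (N + 1))).mul_left (1 + -Y / ((N : ℂ) + 1 - A))
  rw [← tsum_mul_left, ← hs1.tsum_sub hs2]
  -- The certificate is P_{i+1}(B, Y)/(i + 2 + N - A - B), with i = n + N + 1.
  have hg : Tendsto (fun n : ℕ => pochRatio B Y (n + (N + 1) + 1)
      * ((((n + (N + 1) : ℕ) : ℂ) + 2 + N - A - B))⁻¹) atTop (𝓝 0) :=
    (tendsto_add_atTop_iff_nat (N + 1)).2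
      (tendsto_pochRatio_succ_mul hB hY (norm_inv_add_two_add_sub_le hA hB N))
  rw [(hasSum_telescope (hs1.sub hs2) hg fun n => ?_).tsum_eq]
  · simp [add_comm, add_assoc, add_left_comm]
  · have e : n + 1 + (N + 1) + 1 = n + (N + 1) + 1 + 1 := by ring
    have e' : n + 1 + (N + 1) = n + (N + 1) + 1 := by ring
    simp only [connTerm]
    rw [e, e', pochRatio_succ B Y (n + (N + 1) + 1)]
    have n1 := add_two_add_sub_ne_zero hA hB N (n + (N + 1))
    have n2 := add_two_add_sub_ne_zero hA hB N (n + (N + 1) + 1)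
    have n3 := add_two_sub_ne_zero hB (n + (N + 1))
    have n4 := natCast_add_one_sub_ne_zero hB (n + (N + 1) + 1)
    generalize n + (N + 1) = m at *
    generalize pochRatio B Y (m + 1) = p at *
    push_cast at n2 n4 ⊢
    generalize (m : ℂ) = m at *
    generalize (N : ℂ) = N at *
    have n4' : m + 2 - B ≠ 0 := n3
    have e2 : m + 1 + 1 - B = m + 2 - B := by ring
    have e3 : m + 1 + 2 + N - A - B = m + 2 + N - A - B + 1 := by ring
    have e4 : m + 2 + (N + 1) - A - B = m + 2 + N - A - B + 1 := by ring
    rw [e2, e3, e4]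
    rw [e3] at n2
    obtain ⟨u, hu⟩ : ∃ u, u = m + 2 + N - A - B := ⟨_, rfl⟩
    obtain ⟨w, hw⟩ : ∃ w, w = m + 2 - B := ⟨_, rfl⟩
    have : A - N = w - u := by rw [hu, hw]; ring
    rw [← hu] at n1 n2 ⊢
    rw [← hw] at n3 ⊢
    have e5 : N + 1 - A = 1 - (w - u) := by rw [← this]; ring
    have e6 : A - (N + 1) = w - u - 1 := by rw [← this]; ring
    rw [this, e5, e6]
    rw [e5] at hA1
    field_simp
    ring

/-- The `N`-th connected sum; it does not depend on `N`. -/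
noncomputable def connSum (A B Y : ℂ) (N : ℕ) : ℂ :=
  pochRatio B Y N * pochRatio A (-Y) N
      * (1 - Y * (A - B) * (((N : ℂ) + 1 - A) * ((N : ℂ) + 1 - B))⁻¹)
    - Y * (connSeries A B Y N - connSeries B A (-Y) N)

/-- The boundary terms of the two tails are rational multiples of P_N(B, Y) P_N(A, -Y), and they
balance the change of the product term: an identity of rational functions in N. -/
lemma connSum_succ {A B Y : ℂ} (hA : ‖A‖ < 1) (hB : ‖B‖ < 1) (hY : ‖Y‖ < 1) (N : ℕ) :
    connSum A B Y (N + 1) = connSum A B Y N := by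
  have h1 := connSeries_sub_succ hA hB hY N
  have h2 := connSeries_sub_succ hB hA (Y := -Y) (by simpa using hY) N
  rw [connSum, connSum]
  have h3 : connSeries A B Y (N + 1) - connSeries B A (-Y) (N + 1)
      = (connSeries A B Y N - connSeries B A (-Y) N)
        - ((connSeries A B Y N - connSeries A B Y (N + 1))
          - (connSeries B A (-Y) N - connSeries B A (-Y) (N + 1))) := by ring
  rw [h3, h1, h2]
  simp only [connTerm, pochRatio_succ, neg_neg]
  have n1 := natCast_add_one_sub_ne_zero hA N
  have n2 := natCast_add_one_sub_ne_zero hB N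
  have n3 := add_two_sub_ne_zero hA N
  have n4 := add_two_sub_ne_zero hB N
  have n5 := add_two_add_sub_ne_zero hA hB N N
  have n6 := add_two_add_sub_ne_zero hA hB N (N + 1)
  generalize connSeries A B Y N = s
  generalize connSeries B A (-Y) N = s'
  generalize pochRatio B Y N = p
  generalize pochRatio A (-Y) N = q
  push_cast at *
  generalize (N : ℂ) = N at *
  have e1 : N + 1 + 1 - A = N + 2 - A := by ring
  have e2 : N + 1 + 1 - B = N + 2 - B := by ring
  have e3 : N + 2 + N - B - A = N + 2 + N - A - B := by ring
  have e4 : N + 1 + 2 + N - B - A = N + 1 + 2 + N - A - B := by ring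
  rw [e1, e2, e3, e4]
  field_simp
  ring

/-! ### The limit N → ∞ of the connected sum. -/

/-- The product `∏_{1 ≤ j ≤ i} (1 + σ / j)`. -/
noncomputable def realRatio (σ : ℝ) (i : ℕ) : ℝ := ∏ j ∈ range i, (1 + σ / ((j : ℝ) + 1))

lemma realRatio_pos {σ : ℝ} (hσ : 0 ≤ σ) (i : ℕ) : 0 < realRatio σ i :=
  prod_pos fun _ _ => by positivity

lemma realRatio_succ (σ : ℝ) (i : ℕ) :
    realRatio σ (i + 1) = realRatio σ i * (1 + σ / ((i : ℝ) + 1)) := by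
  simp [realRatio, prod_range_succ]

/-- Each summand is h n - h (n + 1) for h n = `realRatio σ (n + N + 1) / ((1 - σ) * (n + N + 2))`,
and h ≥ 0. -/
lemma realRatio_sum_le {σ : ℝ} (hσ0 : 0 ≤ σ) (hσ : σ < 1) (N m : ℕ) :
    ∑ n ∈ range m, realRatio σ (n + N + 1) / (((n : ℝ) + N + 2) * ((n : ℝ) + N + 3))
      ≤ realRatio σ (N + 1) / ((1 - σ) * ((N : ℝ) + 2)) := by
  have h1 : (0 : ℝ) < 1 - σ := by linarith
  have : ∀ n : ℕ, realRatio σ (n + N + 1) / (((n : ℝ) + N + 2) * ((n : ℝ) + N + 3))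
      = realRatio σ (n + N + 1) / ((1 - σ) * ((n : ℝ) + N + 2))
        - realRatio σ (n + 1 + N + 1) / ((1 - σ) * (((n + 1 : ℕ) : ℝ) + N + 2)) := fun n => by
    have e : n + 1 + N + 1 = n + N + 1 + 1 := by ring
    rw [e, realRatio_succ σ (n + N + 1)]
    push_cast
    have e2 : (n : ℝ) + N + 1 + 1 ≠ 0 := by positivity
    have e3 : (n : ℝ) + N + 2 ≠ 0 := by positivity
    have e4 : (n : ℝ) + 1 + N + 2 ≠ 0 := by positivity
    have e5 : (n : ℝ) + N + 3 ≠ 0 := by positivity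
    have e6 : (n : ℝ) + N + 1 + 1 = n + N + 2 := by ring
    have e7 : (n : ℝ) + 1 + N + 2 = n + N + 3 := by ring
    rw [e6, e7]
    field_simp
    ring
  rw [sum_congr rfl fun n _ => this n,
    sum_range_sub' (fun n : ℕ => realRatio σ (n + N + 1) / ((1 - σ) * ((n : ℝ) + N + 2)))]
  have := (realRatio_pos hσ0 (m + N + 1)).le
  have h2 : 0 ≤ realRatio σ (m + N + 1) / ((1 - σ) * ((m : ℝ) + N + 2)) := by positivity
  simp only [zero_add, Nat.cast_zero]
  linarith

/-- Only the factors beyond N are estimated crudely. Keeping ‖P_N(0, Y)‖ itself lets it pair with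
‖P_N(0, -Y)‖, and that product is bounded. -/
lemma norm_pochRatio_zero_le_mul {Y : ℂ} {N i : ℕ} (h : N ≤ i) :
    ‖pochRatio 0 Y i‖ ≤ ‖pochRatio 0 Y N‖ * (realRatio ‖Y‖ i / realRatio ‖Y‖ N) := by
  induction i, h using Nat.le_induction with
  | base => rw [div_self (realRatio_pos (norm_nonneg Y) N).ne', mul_one]
  | succ i _ ih =>
    rw [pochRatio_succ, realRatio_succ, norm_mul, mul_div_right_comm, ← mul_assoc]
    have := realRatio_pos (norm_nonneg Y) i
    have := realRatio_pos (norm_nonneg Y) N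
    refine mul_le_mul ih ?_ (norm_nonneg _) (by positivity)
    refine (norm_add_le _ _).trans ?_
    rw [sub_zero, norm_one, norm_div, norm_natCast_add_one]

/-- Both sides are the partial product ∏ (1 - Y²/j²); the right-hand form has a limit by
`tendsto_pochRatio_div`. -/
lemma pochRatio_zero_mul_neg {Y : ℂ} (hY : ‖Y‖ < 1) (N : ℕ) :
    pochRatio 0 Y N * pochRatio 0 (-Y) N = (pochRatio Y Y N / pochRatio 0 Y N)⁻¹ := by
  rw [inv_div, eq_div_iff]
  · rw [mul_assoc]
    conv_rhs => rw [← mul_one (pochRatio 0 Y N)]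
    congr 1
    rw [pochRatio, pochRatio, ← prod_mul_distrib]
    refine prod_eq_one fun j _ => ?_
    have h1 := natCast_add_one_sub_ne_zero hY j
    have h2 : (j : ℂ) + 1 ≠ 0 := Nat.cast_add_one_ne_zero j
    field_simp
    ring
  · refine prod_ne_zero_iff.2 fun j _ => ?_
    have h1 := natCast_add_one_sub_ne_zero hY j
    rw [one_add_div h1]
    exact div_ne_zero (by simpa using Nat.cast_add_one_ne_zero j) h1

lemma exists_norm_pochRatio_mul_le {Y : ℂ} (hY : ‖Y‖ < 1) :
    ∃ C, 0 ≤ C ∧ ∀ N, ‖pochRatio 0 (-Y) N‖ * ‖pochRatio 0 Y N‖ ≤ C := by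
  have h0 : gammaRatio Y Y ≠ 0 := by
    have h1 : 0 < (1 - Y).re := by
      have := (Complex.re_le_norm Y).trans_lt hY
      simp only [Complex.sub_re, Complex.one_re]
      linarith
    have h2 : 0 < (1 + Y).re := by
      have := (Complex.abs_re_le_norm Y).trans_lt hY
      simp only [Complex.add_re, Complex.one_re]
      linarith [(abs_lt.1 this).1]
    simp [gammaRatio, Complex.Gamma_ne_zero_of_re_pos h1, Complex.Gamma_ne_zero_of_re_pos h2]
  have h := (tendsto_pochRatio_div hY Y).inv₀ h0
  obtain ⟨C, hC⟩ := (Metric.isBounded_range_of_tendsto _ h).exists_norm_le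
  have h3 : ∀ N, ‖pochRatio 0 (-Y) N‖ * ‖pochRatio 0 Y N‖ ≤ C := fun N => by
    rw [← norm_mul, mul_comm, pochRatio_zero_mul_neg hY]
    exact hC _ (Set.mem_range_self N)
  exact ⟨C, (mul_nonneg (norm_nonneg _) (norm_nonneg _)).trans (h3 0), h3⟩

/-- The quotient of the general term of `connSeries A B Y N` by that of its majorant. -/
noncomputable def connFactor (A B Y : ℂ) (p : ℕ × ℕ) : ℂ :=
  pochRatio A (-Y) p.1 / pochRatio 0 (-Y) p.1
    * (pochRatio B Y (p.2 + 1) / pochRatio 0 Y (p.2 + 1))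
    * ((A - p.1) / p.1)
    * (((p.2 + p.1 + 2 : ℕ) : ℂ) / ((p.2 + p.1 + 2 : ℕ) + -(A + B)))
    * (((p.2 + 2 : ℕ) : ℂ) / ((p.2 + 2 : ℕ) + -B))

lemma tendsto_connFactor {A B Y : ℂ} (hA : ‖A‖ < 1) (hB : ‖B‖ < 1) :
    Tendsto (connFactor A B Y) (atTop ×ˢ atTop)
      (𝓝 (-(gammaRatio A (-Y) * gammaRatio B Y))) := by
  have h1 := (tendsto_pochRatio_div hA (-Y)).comp (tendsto_fst (f := atTop) (g := (atTop : Filter ℕ)))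
  have h2 := ((tendsto_pochRatio_div hB Y).comp (tendsto_add_atTop_nat 1)).comp
    (tendsto_snd (f := (atTop : Filter ℕ)) (g := atTop))
  have h3 : Tendsto (fun n : ℕ => (A - n) / (n : ℂ)) atTop (𝓝 (-1)) := by
    have : Tendsto (fun n : ℕ => A / (n : ℂ) - 1) atTop (𝓝 (0 - 1)) :=
      (tendsto_const_div_atTop_nhds_zero_nat A).sub_const 1
    rw [zero_sub] at this
    refine this.congr' ?_
    filter_upwards [eventually_ge_atTop 1] with n hn
    have : (n : ℂ) ≠ 0 := by exact_mod_cast (by omega : n ≠ 0)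
    field_simp
  have h3 := h3.comp (tendsto_fst (f := atTop) (g := (atTop : Filter ℕ)))
  have h4 := (tendsto_natCast_div_add_atTop (𝕜 := ℂ) (-(A + B))).comp
    (show Tendsto (fun p : ℕ × ℕ => p.2 + p.1 + 2) (atTop ×ˢ atTop) atTop from
      tendsto_atTop_mono (fun p => by omega) tendsto_fst)
  have h5 := ((tendsto_natCast_div_add_atTop (𝕜 := ℂ) (-B)).comp (tendsto_add_atTop_nat 2)).comp
    (tendsto_snd (f := (atTop : Filter ℕ)) (g := atTop))
  have h := (((h1.mul h2).mul h3).mul h4).mul h5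
  rw [mul_one, mul_one, mul_neg_one] at h
  exact h

lemma gammaRatio_zero {Y : ℂ} (hY : ‖Y‖ < 1) : gammaRatio 0 Y = 1 := by
  have h2 : 0 < (1 + Y).re := by
    have := (Complex.abs_re_le_norm Y).trans_lt hY
    simp only [Complex.add_re, Complex.one_re]
    linarith [(abs_lt.1 this).1]
  simp [gammaRatio, div_self (Complex.Gamma_ne_zero_of_re_pos h2)]

lemma mul_connTerm_eq {A B Y : ℂ} (hY : ‖Y‖ < 1) {N : ℕ} (hN : 1 ≤ N) (i : ℕ) :
    pochRatio A (-Y) N * connTerm A B Y N i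
      = pochRatio 0 (-Y) N * pochRatio 0 Y (i + 1)
        * ((N : ℂ) / (((i : ℂ) + 2 + N) * ((i : ℂ) + 2))) * connFactor A B Y (N, i) := by
  have n1 := pochRatio_zero_ne_zero (Y := -Y) (by simpa using hY) N
  have n2 := pochRatio_zero_ne_zero hY (i + 1)
  have n3 : (N : ℂ) ≠ 0 := by exact_mod_cast (by omega : N ≠ 0)
  have n4 : (i : ℂ) + 2 ≠ 0 := by exact_mod_cast (by omega : i + 2 ≠ 0)
  have n5 : (i : ℂ) + 2 + N ≠ 0 := by exact_mod_cast (by omega : i + 2 + N ≠ 0)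
  simp only [connTerm, connFactor]
  push_cast
  have e1 : (i : ℂ) + N + 2 + -(A + B) = i + 2 + N - A - B := by ring
  have e2 : (i : ℂ) + N + 2 = i + 2 + N := by ring
  have e3 : (i : ℂ) + 2 + -B = i + 2 - B := by ring
  rw [e1, e2, e3]
  field_simp

/-- Both series share a majorant whose total mass is bounded in N, and their terms are this majorant
times `connFactor`. As the tail starts at i = N, both indices are large, so the factors for (A, B)
and R times those for (0, 0) differ by at most δ uniformly. -/
lemma tendsto_connSeries_sub {A B Y : ℂ} (hA : ‖A‖ < 1) (hB : ‖B‖ < 1) (hY : ‖Y‖ < 1) :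
    Tendsto (fun N => connSeries A B Y N - gammaRatio A (-Y) * gammaRatio B Y * connSeries 0 0 Y N)
      atTop (𝓝 0) := by
  set R := gammaRatio A (-Y) * gammaRatio B Y with hR
  obtain ⟨C, hC0, hC⟩ := exists_norm_pochRatio_mul_le hY
  have hY1 : (0 : ℝ) < 1 - ‖Y‖ := by linarith
  have hY' : ‖-Y‖ < 1 := by simpa using hY
  have hD : Tendsto (fun p => connFactor A B Y p - R * connFactor 0 0 Y p) (atTop ×ˢ atTop) (𝓝 0) := by
    have h1 := tendsto_connFactor (Y := Y) hA hB
    have h2 := tendsto_connFactor (A := 0) (B := 0) (Y := Y) (by simp) (by simp)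
    rw [gammaRatio_zero hY, gammaRatio_zero hY'] at h2
    simpa [hR] using h1.sub (h2.const_mul R)
  rw [Metric.tendsto_atTop]
  intro ε hε
  -- The final bound is 2Cδ/(1 - ‖Y‖), where the 2 comes from `realRatio ‖Y‖ (N + 1) ≤ realRatio ‖Y‖
  -- N * 2`.
  set δ := ε * (1 - ‖Y‖) / (4 * (C + 1)) with hδ
  have hδ0 : 0 < δ := by positivity
  rw [prod_atTop_atTop_eq] at hD
  obtain ⟨⟨n1, n2⟩, hn⟩ := Metric.tendsto_atTop.1 hD δ hδ0
  refine ⟨max (max n1 n2) 1, fun N hN => ?_⟩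
  have hN1 : 1 ≤ N := le_of_max_le_right hN
  have hNn : n1 ≤ N ∧ n2 ≤ N := by omega
  rw [dist_zero_right, connSeries, connSeries, ← tsum_mul_left, ← tsum_mul_left, ← tsum_mul_left]
  have s1 := ((summable_nat_add_iff N).2 (summable_connTerm (Y := Y) hA hB hY N)).mul_left
    (pochRatio A (-Y) N)
  have s2 := (((summable_nat_add_iff N).2 (summable_connTerm (A := 0) (B := 0) (Y := Y) (by simp)
    (by simp) hY N)).mul_left (pochRatio 0 (-Y) N)).mul_left R
  rw [← s1.tsum_sub s2]
  set g : ℕ → ℝ := fun n => (C * δ * ((N : ℝ) + 2) / realRatio ‖Y‖ N)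
    * (realRatio ‖Y‖ (n + N + 1) / (((n : ℝ) + N + 2) * ((n : ℝ) + N + 3))) with hg
  have hpos := fun i => realRatio_pos (norm_nonneg Y) i
  have hg0 : ∀ n, 0 ≤ realRatio ‖Y‖ (n + N + 1) / (((n : ℝ) + N + 2) * ((n : ℝ) + N + 3)) := fun n => by
    have := hpos (n + N + 1)
    positivity
  have hsum := summable_of_sum_range_le hg0 (realRatio_sum_le (norm_nonneg Y) hY N)
  have hle := Real.tsum_le_of_sum_range_le hg0 (realRatio_sum_le (norm_nonneg Y) hY N)
  have hb : ∀ n, ‖pochRatio A (-Y) N * connTerm A B Y N (n + N)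
      - R * (pochRatio 0 (-Y) N * connTerm 0 0 Y N (n + N))‖ ≤ g n := fun n => by
    rw [mul_connTerm_eq hY hN1, mul_connTerm_eq hY hN1]
    have e : ∀ p q r : ℂ, p * q - R * (p * r) = p * (q - R * r) := fun p q r => by ring
    rw [e, norm_mul, norm_mul, norm_mul]
    have b1 := (hn (N, n + N) (Prod.mk_le_mk.2 ⟨hNn.1, by omega⟩)).le
    rw [dist_zero_right] at b1
    have b2 := norm_pochRatio_zero_le_mul (Y := Y) (show N ≤ n + N + 1 by omega)
    -- Here N ≥ 1 replaces n + 2N + 2 by n + N + 3, the shape that `realRatio_sum_le` can sum.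
    have b3 : ‖(N : ℂ) / ((((n + N : ℕ) : ℂ) + 2 + N) * (((n + N : ℕ) : ℂ) + 2))‖
        ≤ ((N : ℝ) + 2) / (((n : ℝ) + N + 2) * ((n : ℝ) + N + 3)) := by
      have h1 : ‖((n + N : ℕ) : ℂ) + 2 + N‖ = (n : ℝ) + N + 2 + N := by
        have := Complex.norm_natCast (n + N + 2 + N)
        push_cast at this ⊢
        exact this
      have h2 : ‖((n + N : ℕ) : ℂ) + 2‖ = (n : ℝ) + N + 2 := by
        have := Complex.norm_natCast (n + N + 2)
        push_cast at this ⊢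
        exact this
      rw [norm_div, norm_mul, h1, h2, Complex.norm_natCast, mul_comm ((n : ℝ) + N + 2 + N)]
      have : (1 : ℝ) ≤ N := by exact_mod_cast hN1
      exact div_le_div₀ (by positivity) (by linarith) (by positivity)
        (mul_le_mul_of_nonneg_left (by linarith) (by positivity))
    have hp := hpos (n + N + 1)
    have hp' := hpos N
    calc _ ≤ ‖pochRatio 0 (-Y) N‖ * (‖pochRatio 0 Y N‖
          * (realRatio ‖Y‖ (n + N + 1) / realRatio ‖Y‖ N))
          * (((N : ℝ) + 2) / (((n : ℝ) + N + 2) * ((n : ℝ) + N + 3))) * δ := by gcongr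
      _ = (‖pochRatio 0 (-Y) N‖ * ‖pochRatio 0 Y N‖)
          * ((realRatio ‖Y‖ (n + N + 1) / realRatio ‖Y‖ N)
          * (((N : ℝ) + 2) / (((n : ℝ) + N + 2) * ((n : ℝ) + N + 3))) * δ) := by ring
      _ ≤ C * ((realRatio ‖Y‖ (n + N + 1) / realRatio ‖Y‖ N)
          * (((N : ℝ) + 2) / (((n : ℝ) + N + 2) * ((n : ℝ) + N + 3))) * δ) := by
            gcongr
            exact hC N
      _ = g n := by rw [hg]; ring
  have hN0 : (0 : ℝ) ≤ N := N.cast_nonneg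
  have hp' := hpos N
  have hr : realRatio ‖Y‖ (N + 1) ≤ realRatio ‖Y‖ N * 2 := by
    rw [realRatio_succ]
    have : ‖Y‖ / ((N : ℝ) + 1) ≤ 1 := by
      rw [div_le_one (by positivity)]
      linarith
    gcongr
    linarith
  calc _ ≤ (C * δ * ((N : ℝ) + 2) / realRatio ‖Y‖ N) * _ :=
        tsum_of_norm_bounded (hsum.hasSum.mul_left _) hb
    _ ≤ (C * δ * ((N : ℝ) + 2) / realRatio ‖Y‖ N)
        * (realRatio ‖Y‖ N * 2 / ((1 - ‖Y‖) * ((N : ℝ) + 2))) := by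
          gcongr
          exact hle.trans (by gcongr)
    _ = 2 * C * δ / (1 - ‖Y‖) := by field_simp
    _ = ε * (C / (2 * (C + 1))) := by rw [hδ]; field_simp; ring
    _ < ε * 1 := by
        gcongr
        rw [div_lt_one (by positivity)]
        linarith
    _ = ε := mul_one _

lemma connSum_zero_eq {A B Y : ℂ} (hA : ‖A‖ < 1) (hB : ‖B‖ < 1) (hY : ‖Y‖ < 1) :
    connSum A B Y 0 = gammaRatio A (-Y) * gammaRatio B Y := by
  set R := gammaRatio A (-Y) * gammaRatio B Y with hR
  have hY' : ‖-Y‖ < 1 := by simpa using hY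
  have hconst : ∀ {A B : ℂ}, ‖A‖ < 1 → ‖B‖ < 1 → ∀ N, connSum A B Y N = connSum A B Y 0 := by
    intro A B hA hB N
    induction N with
    | zero => rfl
    | succ N ih => rw [connSum_succ hA hB hY, ih]
  -- The factor A - N of every term is 0 here, so both series vanish.
  have h00 : connSum 0 0 Y 0 = 1 := by simp [connSum, connSeries, connTerm]
  obtain ⟨C, hC0, hC⟩ := exists_norm_pochRatio_mul_le hY
  have t1 := tendsto_connSeries_sub hA hB hY
  have t2 := tendsto_connSeries_sub hB hA hY'
  rw [neg_neg, mul_comm (gammaRatio B Y), ← hR] at t2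
  rw [← hR] at t1
  have t3 : Tendsto (fun N : ℕ => 1 - Y * (A - B) * (((N : ℂ) + 1 - A) * ((N : ℂ) + 1 - B))⁻¹)
      atTop (𝓝 1) := by
    have := (tendsto_pochRatio_mul (B := 0) (Y := 0) (by simp) (by simp)
      (f := fun N : ℕ => (((N : ℂ) + 1 - A) * ((N : ℂ) + 1 - B))⁻¹)
      (K := (1 - ‖A‖)⁻¹ * (1 - ‖B‖)⁻¹) fun i => by
        refine (norm_inv_mul_inv_le (norm_inv_natCast_add_one_sub_le hA i)
          (norm_inv_natCast_add_one_sub_le hB i)).trans ?_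
        have : (0 : ℝ) < 1 - ‖A‖ := by linarith
        have : (0 : ℝ) < 1 - ‖B‖ := by linarith
        gcongr
        nlinarith [(Nat.cast_nonneg i : (0 : ℝ) ≤ i)]).const_mul (Y * (A - B))
    simpa [pochRatio] using this.const_sub 1
  have t4 : Tendsto (fun N : ℕ => pochRatio 0 Y N * pochRatio 0 (-Y) N
      * (pochRatio B Y N / pochRatio 0 Y N * (pochRatio A (-Y) N / pochRatio 0 (-Y) N)
        * (1 - Y * (A - B) * (((N : ℂ) + 1 - A) * ((N : ℂ) + 1 - B))⁻¹) - R)) atTop (𝓝 0) := by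
    have t5 := (((tendsto_pochRatio_div hB Y).mul (tendsto_pochRatio_div hA (-Y))).mul t3).sub_const R
    rw [mul_one, mul_comm (gammaRatio B Y), ← hR, sub_self] at t5
    have t6 := (t5.norm).const_mul C
    rw [norm_zero, mul_zero] at t6
    refine squeeze_zero_norm (fun N => ?_) t6
    rw [norm_mul, norm_mul, mul_comm ‖pochRatio 0 Y N‖]
    exact mul_le_mul_of_nonneg_right (hC N) (norm_nonneg _)
  have t7 := t4.sub ((t1.sub t2).const_mul Y)
  have t8 : Tendsto (fun _ : ℕ => connSum A B Y 0 - R * connSum 0 0 Y 0) atTop (𝓝 0) := by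
    simp only [sub_zero, mul_zero] at t7
    refine t7.congr fun N => ?_
    rw [← hconst hA hB N, ← hconst (A := 0) (B := 0) (by simp) (by simp) N, connSum, connSum]
    have n1 := pochRatio_zero_ne_zero hY N
    have n2 := pochRatio_zero_ne_zero hY' N
    have e : pochRatio B Y N * pochRatio A (-Y) N
        = pochRatio 0 Y N * pochRatio 0 (-Y) N * (pochRatio B Y N / pochRatio 0 Y N
          * (pochRatio A (-Y) N / pochRatio 0 (-Y) N)) := by field_simp
    rw [e]
    ring
  have := tendsto_nhds_unique t8 tendsto_const_nhds
  rw [h00, mul_one] at this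
  exact sub_eq_zero.1 this.symm

/-! ### Multiple zeta values as iterated series. -/

lemma hasSum_prod_of_nonneg {α β : Type*} {f : α × β → ℝ} (h0 : ∀ x, 0 ≤ f x) {g : α → ℝ} {s : ℝ}
    (hf : ∀ a, HasSum (fun b => f (a, b)) (g a)) (hg : HasSum g s) : HasSum f s := by
  have hs : Summable f := (summable_prod_of_nonneg h0).2
    ⟨fun a => (hf a).summable, hg.summable.congr fun a => (hf a).tsum_eq.symm⟩
  rw [← (hs.hasSum.prod_fiberwise hf).unique hg]
  exact hs.hasSum

/-- The truncated multiple zeta value `∑_{N ≥ m₁ > ⋯ > m_d > 0} 1 / (m₁ ^ l₁ ⋯ m_d ^ l_d)`. -/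
noncomputable def truncMZV : {d : ℕ} → (Fin d → ℕ) → ℕ → ℝ
  | 0, _, _ => 1
  | _ + 1, l, N => ∑ j ∈ range N, (((j : ℝ) + 1) ^ l 0)⁻¹ * truncMZV (Fin.tail l) j

lemma truncMZV_nonneg {d : ℕ} (l : Fin d → ℕ) (N : ℕ) : 0 ≤ truncMZV l N := by
  induction d generalizing N with
  | zero => simp [truncMZV]
  | succ d ih =>
    rw [truncMZV]
    exact sum_nonneg fun j _ => mul_nonneg (by positivity) (ih _ _)

open Classical in
/-- The general term of a multiple zeta value, truncated at `N`. -/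
noncomputable def chainTerm {d : ℕ} (l : Fin d → ℕ) (N : ℕ∞) (m : Fin d → ℕ) : ℝ :=
  if (StrictAnti m ∧ ∀ i, 0 < m i) ∧ ∀ i, (m i : ℕ∞) ≤ N then (∏ i, (m i : ℝ) ^ l i)⁻¹ else 0

lemma chainTerm_nonneg {d : ℕ} (l : Fin d → ℕ) (N : ℕ∞) (m : Fin d → ℕ) : 0 ≤ chainTerm l N m := by
  unfold chainTerm
  split_ifs <;> positivity

lemma chain_cons_iff {d : ℕ} (N : ℕ∞) (j : ℕ) (m : Fin d → ℕ) :
    ((StrictAnti (Fin.cons j m : Fin (d + 1) → ℕ) ∧ ∀ i, 0 < (Fin.cons j m : Fin (d + 1) → ℕ) i)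
        ∧ ∀ i, ((Fin.cons j m : Fin (d + 1) → ℕ) i : ℕ∞) ≤ N)
      ↔ (0 < j ∧ (j : ℕ∞) ≤ N) ∧
        ((StrictAnti m ∧ ∀ i, 0 < m i) ∧ ∀ i, (m i : ℕ∞) ≤ ((j - 1 : ℕ) : ℕ∞)) := by
  constructor
  · rintro ⟨⟨h1, h2⟩, h3⟩
    have hj : 0 < j := by simpa using h2 0
    refine ⟨⟨hj, by simpa using h3 0⟩, ⟨fun a b hab => ?_, fun i => by simpa using h2 i.succ⟩,
      fun i => ?_⟩
    · simpa using h1 (Fin.succ_lt_succ_iff.2 hab)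
    · have : m i < j := by simpa using h1 (Fin.succ_pos i)
      exact_mod_cast (by omega : m i ≤ j - 1)
  · rintro ⟨⟨h1, h2⟩, ⟨h3, h4⟩, h5⟩
    have h6 : ∀ i, m i < j := fun i => by
      have : m i ≤ j - 1 := by exact_mod_cast h5 i
      omega
    refine ⟨⟨fun a b hab => ?_, fun i => ?_⟩, fun i => ?_⟩
    · induction b using Fin.cases with
      | zero => exact absurd hab (Fin.not_lt_zero a)
      | succ b =>
        induction a using Fin.cases with
        | zero => simpa using h6 b
        | succ a => simpa using h3 (Fin.succ_lt_succ_iff.1 hab)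
    · induction i using Fin.cases with
      | zero => simpa using h1
      | succ i => simpa using h4 i
    · induction i using Fin.cases with
      | zero => simpa using h2
      | succ i =>
        simp only [Fin.cons_succ]
        exact le_trans (by exact_mod_cast (h6 i).le) h2

lemma ite_and_eq_mul {P Q : Prop} [Decidable (P ∧ Q)] [Decidable P] [Decidable Q] (a b : ℝ) :
    (if P ∧ Q then a * b else 0) = (if P then a else 0) * (if Q then b else 0) := by
  by_cases hP : P <;> by_cases hQ : Q <;> simp [hP, hQ]

lemma chainTerm_cons {d : ℕ} (l : Fin (d + 1) → ℕ) (N : ℕ∞) (j : ℕ) (m : Fin d → ℕ) :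
    chainTerm l N (Fin.cons j m)
      = (if 0 < j ∧ (j : ℕ∞) ≤ N then ((j : ℝ) ^ l 0)⁻¹ else 0)
        * chainTerm (Fin.tail l) ((j - 1 : ℕ) : ℕ∞) m := by
  unfold chainTerm
  rw [if_congr (chain_cons_iff N j m) rfl rfl]
  simp only [Fin.prod_univ_succ, Fin.cons_zero, Fin.cons_succ, Fin.tail, mul_inv]
  exact ite_and_eq_mul _ _

/-- Peels off the largest index j + 1, leaving a chain bounded by j. With N in `ℕ∞`, finite N gives
the truncated sums and `⊤` the full value. -/
lemma hasSum_chainTerm_succ {d : ℕ} (l : Fin (d + 1) → ℕ) (N : ℕ∞)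
    (ih : ∀ j : ℕ, HasSum (chainTerm (Fin.tail l) (j : ℕ∞)) (truncMZV (Fin.tail l) j)) {s : ℝ}
    (hs : HasSum (fun j : ℕ => if ((j + 1 : ℕ) : ℕ∞) ≤ N then
      (((j : ℝ) + 1) ^ l 0)⁻¹ * truncMZV (Fin.tail l) j else 0) s) :
    HasSum (chainTerm l N) s := by
  rw [← (Fin.consEquiv fun _ : Fin (d + 1) => ℕ).hasSum_iff]
  refine hasSum_prod_of_nonneg (fun _ => chainTerm_nonneg _ _ _)
    (g := fun j : ℕ => (if 0 < j ∧ (j : ℕ∞) ≤ N then ((j : ℝ) ^ l 0)⁻¹ else 0)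
      * truncMZV (Fin.tail l) (j - 1)) (fun j => ?_) ?_
  · simp only [Fin.consEquiv, Equiv.coe_fn_mk, chainTerm_cons]
    exact (ih (j - 1)).mul_left _
  · rw [← hasSum_nat_add_iff' 1]
    simp only [range_one, sum_singleton, lt_self_iff_false, false_and, if_false, zero_mul, sub_zero]
    refine (iff_of_eq ?_).mp hs
    congr 1
    funext j
    push_cast
    by_cases h : (j : ℕ∞) + 1 ≤ N <;> simp [h]

lemma hasSum_chainTerm {d : ℕ} (l : Fin d → ℕ) (N : ℕ) :
    HasSum (chainTerm l (N : ℕ∞)) (truncMZV l N) := by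
  induction d generalizing N with
  | zero =>
    convert hasSum_unique (chainTerm l (N : ℕ∞)) using 1
    rw [chainTerm, if_pos ⟨⟨fun a => a.elim0, fun a => a.elim0⟩, fun a => a.elim0⟩]
    simp [truncMZV]
  | succ d ih =>
    refine hasSum_chainTerm_succ l N (fun j => ih _ j) ?_
    rw [truncMZV]
    have h : HasSum (fun j : ℕ => if ((j + 1 : ℕ) : ℕ∞) ≤ (N : ℕ∞) then
        (((j : ℝ) + 1) ^ l 0)⁻¹ * truncMZV (Fin.tail l) j else 0) (∑ j ∈ range N,
        if ((j + 1 : ℕ) : ℕ∞) ≤ (N : ℕ∞) then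
          (((j : ℝ) + 1) ^ l 0)⁻¹ * truncMZV (Fin.tail l) j else 0) :=
      hasSum_sum_of_ne_finset_zero fun j hj => ?_
    · convert h using 1
      refine sum_congr rfl fun j hj => ?_
      rw [if_pos (by exact_mod_cast mem_range.1 hj)]
    · rw [if_neg]
      rw [mem_range] at hj
      exact_mod_cast hj

lemma multipleZeta_eq_tsum {d : ℕ} (l : Fin (d + 1) → ℕ)
    (hs : Summable fun j : ℕ => (((j : ℝ) + 1) ^ l 0)⁻¹ * truncMZV (Fin.tail l) j) :
    multipleZeta l = ∑' j : ℕ, (((j : ℝ) + 1) ^ l 0)⁻¹ * truncMZV (Fin.tail l) j := by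
  have h := hasSum_chainTerm_succ l ⊤ (fun j => hasSum_chainTerm _ j) (s := _) (by simpa using hs.hasSum)
  rw [← h.tsum_eq, multipleZeta]
  rw [show (∑' m : {m : Fin (d + 1) → ℕ // StrictAnti m ∧ ∀ i, 0 < m i}, 1 / ∏ i, (m.1 i : ℝ) ^ l i)
    = _ from tsum_subtype {m : Fin (d + 1) → ℕ | StrictAnti m ∧ ∀ i, 0 < m i}
      (fun m => 1 / ∏ i, (m i : ℝ) ^ l i)]
  refine tsum_congr fun m => ?_
  simp [chainTerm, Set.indicator_apply]

/-! ### Generating functions of the truncated sums. -/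

/-- The generating coefficients of the truncated multiple zeta values of depth `d` and
weight `d + r`. -/
noncomputable def truncSum : ℕ → ℕ → ℕ → ℝ
  | 0, r, _ => if r = 0 then 1 else 0
  | d + 1, r, N => ∑ j ∈ range N, ∑ p ∈ antidiagonal r,
      (((j : ℝ) + 1) ^ (p.1 + 1))⁻¹ * truncSum d p.2 j

lemma truncSum_nonneg (d r N : ℕ) : 0 ≤ truncSum d r N := by
  induction d generalizing r N with
  | zero => rw [truncSum]; split_ifs <;> simp
  | succ d ih =>
    rw [truncSum]
    exact sum_nonneg fun j _ => sum_nonneg fun p _ => mul_nonneg (by positivity) (ih _ _)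

lemma truncSum_eq_zero {d N : ℕ} (h : N < d) (r : ℕ) : truncSum d r N = 0 := by
  induction d generalizing r N with
  | zero => omega
  | succ d ih =>
    rw [truncSum]
    refine sum_eq_zero fun j hj => sum_eq_zero fun p _ => ?_
    rw [ih (by have := mem_range.1 hj; omega), mul_zero]

lemma sum_antidiagonalTuple_succ {α : Type*} [AddCommMonoid α] (d r : ℕ) (f : (Fin (d + 1) → ℕ) → α) :
    ∑ t ∈ Finset.Nat.antidiagonalTuple (d + 1) r, f t
      = ∑ p ∈ antidiagonal r, ∑ t ∈ Finset.Nat.antidiagonalTuple d p.2, f (Fin.cons p.1 t) := by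
  rw [sum_sigma']
  refine sum_bij' (fun t _ => ⟨(t 0, ∑ i, Fin.tail t i), Fin.tail t⟩) (fun q _ => Fin.cons q.1.1 q.2)
    ?_ ?_ ?_ ?_ ?_
  · intro t ht
    rw [Finset.Nat.mem_antidiagonalTuple, Fin.sum_univ_succ] at ht
    simp only [mem_sigma, HasAntidiagonal.mem_antidiagonal, Finset.Nat.mem_antidiagonalTuple]
    exact ⟨ht, trivial⟩
  · rintro ⟨⟨a, b⟩, t⟩ hq
    simp only [mem_sigma, HasAntidiagonal.mem_antidiagonal, Finset.Nat.mem_antidiagonalTuple] at hq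
    rw [Finset.Nat.mem_antidiagonalTuple, Fin.sum_univ_succ]
    simp [hq.1, hq.2]
  · intro t _
    simp
  · rintro ⟨⟨a, b⟩, t⟩ hq
    simp only [mem_sigma, HasAntidiagonal.mem_antidiagonal, Finset.Nat.mem_antidiagonalTuple] at hq
    simp [hq.2]
  · intro t _
    simp

lemma truncSum_eq (d r N : ℕ) :
    truncSum d r N = ∑ t ∈ Finset.Nat.antidiagonalTuple d r, truncMZV (fun i => t i + 1) N := by
  induction d generalizing r N with
  | zero => cases r <;> simp [truncSum, truncMZV]
  | succ d ih =>
    rw [sum_antidiagonalTuple_succ, truncSum, sum_comm]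
    refine sum_congr rfl fun p _ => ?_
    simp only [truncMZV, ih, mul_sum, Fin.cons_zero]
    rw [sum_comm]
    refine sum_congr rfl fun t _ => sum_congr rfl fun j _ => ?_
    congr 2

/-- The elementary symmetric function of degree `d` of the `1 / (j - B)`, `1 ≤ j ≤ N`. -/
noncomputable def invEsymm (B : ℂ) : ℕ → ℕ → ℂ
  | 0, _ => 1
  | d + 1, N => ∑ j ∈ range N, ((j : ℂ) + 1 - B)⁻¹ * invEsymm B d j

lemma hasSum_geom_inv {B z : ℂ} (h : ‖B‖ < ‖z‖) :
    HasSum (fun s : ℕ => (z ^ (s + 1))⁻¹ * B ^ s) (z - B)⁻¹ ∧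
      Summable fun s : ℕ => ‖(z ^ (s + 1))⁻¹ * B ^ s‖ := by
  have hz : z ≠ 0 := norm_pos_iff.1 ((norm_nonneg B).trans_lt h)
  have h1 : ‖B / z‖ < 1 := by rwa [norm_div, div_lt_one (norm_pos_iff.2 hz)]
  have e : ∀ s : ℕ, (z ^ (s + 1))⁻¹ * B ^ s = z⁻¹ * (B / z) ^ s := fun s => by
    rw [div_pow, pow_succ]
    field_simp
  have hzB : z - B ≠ 0 := fun h0 => by rw [sub_eq_zero.1 h0] at h; exact lt_irrefl _ h
  simp only [e]
  constructor
  · have h2 := (hasSum_geometric_of_norm_lt_one h1).mul_left z⁻¹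
    rwa [← mul_inv, mul_sub, mul_div_cancel₀ _ hz, mul_one] at h2
  · simp only [norm_mul, norm_pow]
    exact (summable_geometric_of_lt_one (norm_nonneg _) h1).mul_left _

lemma hasSum_cauchy_prod {f g : ℕ → ℂ} {a b : ℂ} (hf : HasSum f a ∧ Summable fun n => ‖f n‖)
    (hg : HasSum g b ∧ Summable fun n => ‖g n‖) :
    HasSum (fun n => ∑ p ∈ antidiagonal n, f p.1 * g p.2) (a * b) ∧
      Summable fun n => ‖∑ p ∈ antidiagonal n, f p.1 * g p.2‖ := by
  have h := summable_norm_sum_mul_antidiagonal_of_summable_norm hf.2 hg.2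
  refine ⟨?_, h⟩
  rw [← hf.1.tsum_eq, ← hg.1.tsum_eq,
    tsum_mul_tsum_eq_tsum_sum_antidiagonal_of_summable_norm hf.2 hg.2]
  exact h.of_norm.hasSum

lemma hasSum_truncSum {B : ℂ} (hB : ‖B‖ < 1) (d N : ℕ) :
    HasSum (fun r => (truncSum d r N : ℂ) * B ^ r) (invEsymm B d N) ∧
      Summable fun r => ‖(truncSum d r N : ℂ) * B ^ r‖ := by
  induction d generalizing N with
  | zero =>
    constructor
    · convert hasSum_single (f := fun r => (truncSum 0 r N : ℂ) * B ^ r) 0 (fun r hr => ?_) using 1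
      · simp [truncSum, invEsymm]
      · simp [truncSum, hr]
    · refine summable_of_ne_finset_zero (s := {0}) fun r hr => ?_
      have : r ≠ 0 := by simpa using hr
      simp [truncSum, this]
  | succ d ih =>
    have hj : ∀ j : ℕ, ‖B‖ < ‖(j : ℂ) + 1‖ := fun j => by
      rw [norm_natCast_add_one]
      linarith [(Nat.cast_nonneg j : (0 : ℝ) ≤ j)]
    have e : ∀ r, (truncSum (d + 1) r N : ℂ) * B ^ r = ∑ j ∈ range N, ∑ p ∈ antidiagonal r,
        (((j : ℂ) + 1) ^ (p.1 + 1))⁻¹ * B ^ p.1 * ((truncSum d p.2 j : ℂ) * B ^ p.2) := fun r => by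
      rw [truncSum]
      push_cast
      rw [sum_mul]
      refine sum_congr rfl fun j _ => ?_
      rw [sum_mul]
      refine sum_congr rfl fun p hp => ?_
      rw [← HasAntidiagonal.mem_antidiagonal.1 hp, pow_add]
      ring
    have hmul := fun j => hasSum_cauchy_prod (hasSum_geom_inv (hj j)) (ih j)
    simp only [e]
    exact ⟨hasSum_sum fun j _ => (hmul j).1, Summable.of_nonneg_of_le (fun _ => norm_nonneg _)
      (fun r => norm_sum_le _ _) (summable_sum fun j _ => (hmul j).2)⟩

/-- The product expands into elementary symmetric functions; the induction sorts the monomials by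
their largest index. -/
lemma hasSum_invEsymm (B Y : ℂ) (N : ℕ) :
    HasSum (fun d => Y ^ d * invEsymm B d N) (pochRatio B Y N) := by
  induction N using Nat.strong_induction_on with
  | _ N ih =>
    have h : pochRatio B Y N = 1 + ∑ j ∈ range N, Y * ((j : ℂ) + 1 - B)⁻¹ * pochRatio B Y j := by
      clear ih
      induction N with
      | zero => simp
      | succ N ih => rw [pochRatio_succ, sum_range_succ, ← add_assoc, ← ih]; ring
    rw [← hasSum_nat_add_iff' 1, h]
    simp only [range_one, sum_singleton, pow_zero, one_mul, invEsymm, add_sub_cancel_left]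
    have : ∀ d, Y ^ (d + 1) * ∑ j ∈ range N, ((j : ℂ) + 1 - B)⁻¹ * invEsymm B d j
        = ∑ j ∈ range N, Y * ((j : ℂ) + 1 - B)⁻¹ * (Y ^ d * invEsymm B d j) := fun d => by
      rw [mul_sum]
      refine sum_congr rfl fun j _ => ?_
      ring
    simp only [this]
    exact hasSum_sum fun j hj => (ih j (mem_range.1 hj)).mul_left _

lemma hasSum_truncSum_prod {B : ℂ} (hB : ‖B‖ < 1) (Y : ℂ) (N : ℕ) :
    HasSum (fun q : ℕ × ℕ => (truncSum q.1 q.2 N : ℂ) * B ^ q.2 * Y ^ q.1) (pochRatio B Y N) ∧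
      Summable fun q : ℕ × ℕ => ‖(truncSum q.1 q.2 N : ℂ) * B ^ q.2 * Y ^ q.1‖ := by
  have hs : Summable fun q : ℕ × ℕ => ‖(truncSum q.1 q.2 N : ℂ) * B ^ q.2 * Y ^ q.1‖ := by
    refine (summable_prod_of_nonneg fun _ => norm_nonneg _).2 ⟨fun d => ?_, ?_⟩
    · simp only [norm_mul _ (Y ^ _)]
      exact (hasSum_truncSum hB d N).2.mul_right _
    · refine summable_of_ne_finset_zero (s := range (N + 1)) fun d hd => ?_
      rw [mem_range] at hd
      simp [truncSum_eq_zero (by omega : N < d)]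
  refine ⟨?_, hs⟩
  have h1 := hs.of_norm.hasSum
  have h2 := h1.prod_fiberwise fun d => (hasSum_truncSum hB d N).1.mul_right (Y ^ d)
  simp only [mul_comm (invEsymm _ _ _)] at h2
  rw [← h2.unique (hasSum_invEsymm B Y N)]
  exact h1

lemma hasSum_truncSum_real {β η : ℝ} (hβ0 : 0 ≤ β) (hβ : β < 1) (N : ℕ) :
    HasSum (fun q : ℕ × ℕ => truncSum q.1 q.2 N * β ^ q.2 * η ^ q.1) (pochRatio β η N).re := by
  have h := Complex.reCLM.hasSum (hasSum_truncSum_prod (B := β)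
    (by rwa [Complex.norm_real, Real.norm_of_nonneg hβ0]) (η : ℂ) N).1
  refine (iff_of_eq ?_).mp h
  congr 1
  funext q
  rw [Complex.reCLM_apply, ← Complex.ofReal_re (truncSum q.1 q.2 N * β ^ q.2 * η ^ q.1)]
  push_cast
  rfl

lemma exists_re_pochRatio_le {β η : ℝ} (hβ0 : 0 ≤ β) (hβ : β < 1) (hη0 : 0 ≤ η) (hη : η < 1) :
    ∃ C, 0 ≤ C ∧ ∀ N : ℕ, (pochRatio β η N).re ≤ C * ((N : ℝ) + 1) ^ η := by
  obtain ⟨C, hC0, hC⟩ := exists_norm_pochRatio_le (B := β) (Y := η)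
    (by rwa [Complex.norm_real, Real.norm_of_nonneg hβ0])
    (by rwa [Complex.norm_real, Real.norm_of_nonneg hη0])
  refine ⟨C, hC0, fun N => (Complex.re_le_norm _).trans ?_⟩
  have := hC N
  rwa [Complex.norm_real, Real.norm_of_nonneg hη0] at this

/-- A single nonnegative coefficient is at most 2^(d+r) times the generating function at B = Y =
1/2, which is O(√N). -/
lemma summable_truncSum (d s r : ℕ) :
    Summable fun N : ℕ => (((N : ℝ) + 1) ^ (s + 2))⁻¹ * truncSum d r N := by
  obtain ⟨C, hC0, hC⟩ := exists_re_pochRatio_le (β := 1 / 2) (η := 1 / 2) (by norm_num)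
    (by norm_num) (by norm_num) (by norm_num)
  refine Summable.of_nonneg_of_le (fun N => mul_nonneg (by positivity) (truncSum_nonneg _ _ _))
    (fun N => ?_) ((summable_rpow_div_sq (σ := 1 / 2) (by norm_num)).mul_left (2 ^ (d + r) * C))
  have h1 := le_hasSum (hasSum_truncSum_real (β := 1 / 2) (η := 1 / 2) (by norm_num) (by norm_num) N)
    (d, r) fun q _ => by have := truncSum_nonneg q.1 q.2 N; positivity
  have h2 : truncSum d r N ≤ 2 ^ (d + r) * (C * ((N : ℝ) + 1) ^ (1 / 2 : ℝ)) := by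
    calc truncSum d r N = 2 ^ (d + r) * (truncSum d r N * (1 / 2) ^ r * (1 / 2) ^ d) := by
          rw [mul_assoc (truncSum d r N), ← pow_add, add_comm r d, mul_comm (truncSum d r N),
            ← mul_assoc, ← mul_pow]
          norm_num
      _ ≤ _ := by
          exact mul_le_mul_of_nonneg_left (h1.trans (hC N)) (by positivity)
  have h3 : (((N : ℝ) + 1) ^ (s + 2))⁻¹ ≤ (((N : ℝ) + 1) ^ 2)⁻¹ := by
    gcongr
    · linarith [(Nat.cast_nonneg N : (0 : ℝ) ≤ N)]
    · omega
  calc _ ≤ (((N : ℝ) + 1) ^ 2)⁻¹ * (2 ^ (d + r) * (C * ((N : ℝ) + 1) ^ (1 / 2 : ℝ))) :=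
        mul_le_mul h3 h2 (truncSum_nonneg _ _ _) (by positivity)
    _ = _ := by ring

/-! ### Weighted sums in terms of the first entry. -/

/-- The sum of the multiple zeta values of depth `d + 1` with first entry `s + 2` and weight
`d + s + r + 2`. -/
noncomputable def depthSum (d s r : ℕ) : ℝ :=
  ∑' N : ℕ, (((N : ℝ) + 1) ^ (s + 2))⁻¹ * truncSum d r N

lemma depthSum_eq (d s r : ℕ) :
    depthSum d s r = ∑ t ∈ Finset.Nat.antidiagonalTuple d r,
      multipleZeta (Fin.cons (s + 2) fun i => t i + 1 : Fin (d + 1) → ℕ) := by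
  have hs : ∀ t ∈ Finset.Nat.antidiagonalTuple d r,
      Summable fun N : ℕ => (((N : ℝ) + 1) ^ (s + 2))⁻¹ * truncMZV (fun i => t i + 1) N := by
    intro t ht
    refine Summable.of_nonneg_of_le (fun N => mul_nonneg (by positivity) (truncMZV_nonneg _ _))
      (fun N => ?_) (summable_truncSum d s r)
    rw [truncSum_eq]
    gcongr
    exact single_le_sum (f := fun t : Fin d → ℕ => truncMZV (fun i => t i + 1) N)
      (fun t _ => truncMZV_nonneg _ _) ht
  rw [depthSum]
  simp only [truncSum_eq, mul_sum]
  rw [Summable.tsum_finsetSum hs]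
  refine sum_congr rfl fun t ht => ?_
  rw [multipleZeta_eq_tsum]
  · rfl
  · exact hs t ht

lemma sum_admissibleIndices (d k : ℕ) (f : (Fin (d + 1) → ℕ) → ℂ) :
    ∑ t ∈ admissibleIndices (d + k + 2) d, f t
      = ∑ p ∈ antidiagonal k, ∑ t ∈ Finset.Nat.antidiagonalTuple d p.2,
        f (Fin.cons (p.1 + 2) fun i => t i + 1) := by
  rw [sum_sigma', admissibleIndices]
  refine sum_bij' (fun t _ => ⟨(t 0 - 2, ∑ i, (Fin.tail t i - 1)), fun i => Fin.tail t i - 1⟩)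
    (fun q _ => Fin.cons (q.1.1 + 2) fun i => q.2 i + 1) ?_ ?_ ?_ ?_ ?_
  · intro t ht
    rw [mem_filter, Finset.Nat.mem_antidiagonalTuple, Fin.sum_univ_succ] at ht
    obtain ⟨h1, h2, h3⟩ := ht
    simp only [mem_sigma, HasAntidiagonal.mem_antidiagonal, Finset.Nat.mem_antidiagonalTuple, and_true]
    have h4 : ∑ i : Fin d, t i.succ = ∑ i : Fin d, (Fin.tail t i - 1) + d := by
      have h5 : ∑ i : Fin d, (Fin.tail t i - 1) + d = ∑ i : Fin d, (Fin.tail t i - 1 + 1) := by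
        simp [sum_add_distrib]
      rw [h5]
      refine sum_congr rfl fun i _ => ?_
      have := h3 i.succ
      simp only [Fin.tail]
      omega
    omega
  · rintro ⟨⟨a, b⟩, t⟩ hq
    simp only [mem_sigma, HasAntidiagonal.mem_antidiagonal, Finset.Nat.mem_antidiagonalTuple] at hq
    rw [mem_filter, Finset.Nat.mem_antidiagonalTuple, Fin.sum_univ_succ]
    simp only [Fin.cons_zero, Fin.cons_succ, sum_add_distrib, hq.2]
    refine ⟨by simp; omega, by omega, fun i => ?_⟩
    induction i using Fin.cases <;> simp
  · intro t ht
    rw [mem_filter] at ht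
    obtain ⟨-, h2, h3⟩ := ht
    funext i
    induction i using Fin.cases with
    | zero => simp only [Fin.cons_zero]; omega
    | succ i =>
      have := h3 i.succ
      simp only [Fin.cons_succ, Fin.tail]
      omega
  · rintro ⟨⟨a, b⟩, t⟩ hq
    simp only [mem_sigma, HasAntidiagonal.mem_antidiagonal, Finset.Nat.mem_antidiagonalTuple] at hq
    simp [Fin.tail, hq.2]
  · intro t ht
    rw [mem_filter] at ht
    obtain ⟨-, h2, h3⟩ := ht
    congr 1
    funext i
    induction i using Fin.cases with
    | zero => simp only [Fin.cons_zero]; omega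
    | succ i =>
      have := h3 i.succ
      simp only [Fin.cons_succ, Fin.tail]
      omega

lemma weightedSumMZV_eq (d k : ℕ) (u v : ℂ) :
    weightedSumMZV (d + k + 2) (d + 1) u v
      = ∑ p ∈ antidiagonal k, u ^ (p.1 + 1) * v ^ p.2 * (depthSum d p.1 p.2 : ℂ) := by
  rw [weightedSumMZV, sum_admissibleIndices]
  refine sum_congr rfl fun p hp => ?_
  rw [depthSum_eq]
  push_cast
  rw [mul_sum]
  refine sum_congr rfl fun t _ => ?_
  have := HasAntidiagonal.mem_antidiagonal.1 hp
  rw [Fin.cons_zero, show p.1 + 2 - 1 = p.1 + 1 by omega,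
    show d + k + 2 - (p.1 + 2) - d = p.2 by omega]

/-- In depth one the second parameter has exponent 0. Hence the two depth-one weighted sums agree
and cancel through the sign (-1)^1. -/
lemma weightedSumMZV_one (k : ℕ) (u v w : ℂ) :
    weightedSumMZV (0 + k + 2) (0 + 1) u v = weightedSumMZV (0 + k + 2) (0 + 1) u w := by
  rw [weightedSumMZV_eq, weightedSumMZV_eq]
  refine sum_congr rfl fun p _ => ?_
  by_cases h : p.2 = 0
  · simp [h]
  · simp [depthSum, truncSum, h]

/-! ### Generating series of the weighted sums. -/

/-- The joint family behind the generating series of the weighted sums of depth at least two. -/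
noncomputable def jointTerm (a B Y : ℂ) (q : ℕ × (ℕ × (ℕ × ℕ))) : ℂ :=
  (((q.1 : ℂ) + 2) ^ (q.2.1 + 2))⁻¹ * a ^ (q.2.1 + 1)
    * ((truncSum (q.2.2.1 + 1) q.2.2.2 (q.1 + 1) : ℂ) * B ^ q.2.2.2 * Y ^ (q.2.2.1 + 2))

lemma norm_natCast_add_two (j : ℕ) : ‖(j : ℂ) + 2‖ = (j : ℝ) + 2 := by
  have := Complex.norm_natCast (j + 2)
  push_cast at this
  exact this

/-- In depth at least two the largest index M + 2 is at least 2. So ‖a‖ < 2 suffices, which is all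
that is known for a = A + B. -/
lemma hasSum_geom_shift {a : ℂ} (ha : ‖a‖ < 2) (M : ℕ) :
    HasSum (fun s : ℕ => (((M : ℂ) + 2) ^ (s + 2))⁻¹ * a ^ (s + 1))
        (a * (((M : ℂ) + 2) * ((M : ℂ) + 2 - a))⁻¹) ∧
      Summable fun s : ℕ => ‖(((M : ℂ) + 2) ^ (s + 2))⁻¹ * a ^ (s + 1)‖ := by
  have h : ‖a‖ < ‖(M : ℂ) + 2‖ := by
    rw [norm_natCast_add_two]
    linarith [(Nat.cast_nonneg M : (0 : ℝ) ≤ M)]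
  obtain ⟨h1, h2⟩ := hasSum_geom_inv h
  have e : ∀ s : ℕ, (((M : ℂ) + 2) ^ (s + 2))⁻¹ * a ^ (s + 1)
      = a * ((M : ℂ) + 2)⁻¹ * ((((M : ℂ) + 2) ^ (s + 1))⁻¹ * a ^ s) := fun s => by
    rw [pow_succ _ (s + 1), pow_succ a, mul_inv]
    ring
  simp only [e]
  constructor
  · rw [mul_inv, ← mul_assoc]
    exact h1.mul_left _
  · simp only [norm_mul (a * _)]
    exact h2.mul_left _

lemma hasSum_truncSum_succ {B : ℂ} (hB : ‖B‖ < 1) (Y : ℂ) (N : ℕ) :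
    HasSum (fun q : ℕ × ℕ => (truncSum (q.1 + 1) q.2 N : ℂ) * B ^ q.2 * Y ^ (q.1 + 2))
        (Y * (pochRatio B Y N - 1)) ∧
      Summable fun q : ℕ × ℕ => ‖(truncSum (q.1 + 1) q.2 N : ℂ) * B ^ q.2 * Y ^ (q.1 + 2)‖ := by
  obtain ⟨-, h2⟩ := hasSum_truncSum_prod hB Y N
  have hinj : Function.Injective fun q : ℕ × ℕ => (q.1 + 1, q.2) := fun p q h => by
    simp only [Prod.mk.injEq, add_left_inj] at h
    exact Prod.ext h.1 h.2
  have e : ∀ q : ℕ × ℕ, (truncSum (q.1 + 1) q.2 N : ℂ) * B ^ q.2 * Y ^ (q.1 + 2)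
      = Y * ((truncSum (q.1 + 1) q.2 N : ℂ) * B ^ q.2 * Y ^ (q.1 + 1)) := fun q => by ring
  simp only [e]
  have hs := h2.comp_injective hinj
  simp only [Function.comp_def] at hs
  constructor
  · refine HasSum.mul_left _ ?_
    have h3 := hs.of_norm.hasSum.prod_fiberwise fun d =>
      (hasSum_truncSum hB (d + 1) N).1.mul_right (Y ^ (d + 1))
    have h4 := (hasSum_nat_add_iff' 1).2 (hasSum_invEsymm B Y N)
    simp only [range_one, sum_singleton, pow_zero, one_mul, invEsymm] at h4
    simp only [mul_comm (invEsymm _ _ _)] at h3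
    rw [← h3.unique h4]
    exact hs.of_norm.hasSum
  · simp only [norm_mul Y]
    exact hs.mul_left _

lemma norm_add_two_mul_inv_le {a : ℂ} (ha : ‖a‖ < 2) :
    ∃ K, 0 ≤ K ∧ ∀ M : ℕ, ‖(((M : ℂ) + 2) * ((M : ℂ) + 2 - a))⁻¹‖ ≤ K / ((M : ℝ) + 1) ^ 2 := by
  have h2 : 0 < 2 - ‖a‖ := by linarith
  refine ⟨1 * (2 / (2 - ‖a‖)), by positivity, fun M => norm_inv_mul_inv_le ?_ ?_⟩
  · simpa using norm_inv_add_two_sub_le (B := 0) (by simp) M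
  · have h1 : ‖(M : ℂ) + 2‖ - ‖a‖ ≤ ‖(M : ℂ) + 2 - a‖ := norm_sub_norm_le _ _
    rw [norm_natCast_add_two] at h1
    have hM : (0 : ℝ) ≤ M := M.cast_nonneg
    have h3 : (2 - ‖a‖) / 2 * ((M : ℝ) + 1) ≤ ‖(M : ℂ) + 2 - a‖ := by
      nlinarith [norm_nonneg a]
    rw [norm_inv, ← inv_div (2 - ‖a‖), div_eq_mul_inv _ ((M : ℝ) + 1), ← mul_inv]
    exact inv_anti₀ (by positivity) h3

lemma hasSum_mul_prod {ι κ : Type*} {f : ι → ℂ} {g : κ → ℂ} {a b : ℂ}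
    (hf : HasSum f a ∧ Summable fun n => ‖f n‖) (hg : HasSum g b ∧ Summable fun n => ‖g n‖) :
    HasSum (fun x : ι × κ => f x.1 * g x.2) (a * b) :=
  hf.1.mul hg.1 (summable_mul_of_summable_norm hf.2 hg.2)

lemma hasSum_jointTerm_fiber {a B : ℂ} (ha : ‖a‖ < 2) (hB : ‖B‖ < 1) (Y : ℂ) (M : ℕ) :
    HasSum (fun q => jointTerm a B Y (M, q))
      (a * (((M : ℂ) + 2) * ((M : ℂ) + 2 - a))⁻¹ * (Y * (pochRatio B Y (M + 1) - 1))) := by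
  have h := hasSum_mul_prod (hasSum_geom_shift ha M) (hasSum_truncSum_succ hB Y (M + 1))
  simp only [jointTerm]
  exact h

/-- The coefficients are nonnegative, so absolute summability reduces to the fibre sums at the real
parameters ‖a‖, ‖B‖, ‖Y‖. -/
lemma jointTerm_norm (a B Y : ℂ) (q : ℕ × (ℕ × (ℕ × ℕ))) :
    ‖jointTerm a B Y q‖ = (jointTerm ‖a‖ ‖B‖ ‖Y‖ q).re := by
  have : jointTerm ‖a‖ ‖B‖ ‖Y‖ q = ((‖jointTerm a B Y q‖ : ℝ) : ℂ) := by
    have h0 := truncSum_nonneg (q.2.2.1 + 1) q.2.2.2 (q.1 + 1)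
    simp only [jointTerm, norm_mul, norm_inv, norm_pow, norm_natCast_add_two, Complex.norm_real,
      Real.norm_of_nonneg h0]
    push_cast
    rfl
  rw [this, Complex.ofReal_re]

lemma summable_jointTerm {a B Y : ℂ} (ha : ‖a‖ < 2) (hB : ‖B‖ < 1) (hY : ‖Y‖ < 1) :
    Summable fun q => ‖jointTerm a B Y q‖ := by
  have hB' : ‖((‖B‖ : ℝ) : ℂ)‖ < 1 := by simpa using hB
  have hY' : ‖((‖Y‖ : ℝ) : ℂ)‖ < 1 := by simpa using hY
  have ha' : ‖((‖a‖ : ℝ) : ℂ)‖ < 2 := by simpa using ha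
  have hin' : ∀ M : ℕ, HasSum (fun q => ‖jointTerm a B Y (M, q)‖)
      (‖a‖ * (((M : ℂ) + 2) * ((M : ℂ) + 2 - ‖a‖))⁻¹
        * (‖Y‖ * (pochRatio ‖B‖ ‖Y‖ (M + 1) - 1))).re := fun M => by
    simp only [jointTerm_norm a B Y]
    exact Complex.reCLM.hasSum (hasSum_jointTerm_fiber ha' hB' ‖Y‖ M)
  refine (summable_prod_of_nonneg fun _ => norm_nonneg _).2 ⟨fun M => (hin' M).summable, ?_⟩
  simp only [(hin' _).tsum_eq]
  obtain ⟨K, hK0, hK⟩ := norm_add_two_mul_inv_le ha'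
  have hs1 := (summable_norm_pochRatio_succ_mul hB' hY' hK).of_norm
  have hs2 := (summable_norm_pochRatio_succ_mul (B := 0) (Y := 0) (by simp) (by simp) hK).of_norm
  have hs3 : Summable fun M : ℕ => (‖a‖ : ℂ) * (((M : ℂ) + 2) * ((M : ℂ) + 2 - ‖a‖))⁻¹
      * (‖Y‖ * (pochRatio ‖B‖ ‖Y‖ (M + 1) - 1)) := by
    refine ((hs1.sub hs2).mul_left ((‖a‖ : ℂ) * ‖Y‖)).congr fun M => ?_
    simp only [pochRatio, zero_div, add_zero, prod_const_one]
    ring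
  exact Complex.reCLM.summable hs3

lemma hasSum_weighted {a B Y : ℂ} (ha : ‖a‖ < 2) (hB : ‖B‖ < 1) (hY : ‖Y‖ < 1) {V : ℂ}
    (hV : HasSum (fun M : ℕ => a * (((M : ℂ) + 2) * ((M : ℂ) + 2 - a))⁻¹
      * (Y * (pochRatio B Y (M + 1) - 1))) V) :
    HasSum (fun q : ℕ × ℕ => ∑ p ∈ antidiagonal q.2, a ^ (p.1 + 1) * B ^ p.2
      * (depthSum (q.1 + 1) p.1 p.2 : ℂ) * Y ^ (q.1 + 2)) V := by
  have hs := (summable_jointTerm ha hB hY).of_norm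
  have h0 : HasSum (jointTerm a B Y) V := by
    have h := hs.hasSum.prod_fiberwise (hasSum_jointTerm_fiber ha hB Y)
    rw [← h.unique hV]
    exact hs.hasSum
  have h1 := (Equiv.prodComm (ℕ × (ℕ × ℕ)) ℕ).hasSum_iff.2 h0
  have h2 : HasSum (fun q : ℕ × (ℕ × ℕ) => a ^ (q.1 + 1) * B ^ q.2.2
      * (depthSum (q.2.1 + 1) q.1 q.2.2 : ℂ) * Y ^ (q.2.1 + 2)) V := by
    refine h1.prod_fiberwise fun q => ?_
    -- The term of largest index 1 is dropped: no smaller positive index exists for the rest of the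
    -- chain.
    have h3 := (hasSum_nat_add_iff' 1).2 (summable_truncSum (q.2.1 + 1) q.1 q.2.2).hasSum
    simp only [range_one, sum_singleton, truncSum_eq_zero (Nat.succ_pos _), mul_zero, sub_zero] at h3
    have h4 := (Complex.hasSum_ofReal.2 h3).mul_left (a ^ (q.1 + 1) * B ^ q.2.2 * Y ^ (q.2.1 + 2))
    rw [mul_right_comm]
    refine (iff_of_eq ?_).mp h4
    congr 1
    funext M
    simp only [Function.comp, Equiv.prodComm_apply, Prod.swap, jointTerm]
    push_cast
    rw [show (M : ℂ) + 1 + 1 = M + 2 by ring]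
    ring
  let e : (Σ q : ℕ × ℕ, antidiagonal q.2) ≃ ℕ × (ℕ × ℕ) :=
    { toFun := fun x => (x.2.1.1, (x.1.1, x.2.1.2))
      invFun := fun x => ⟨(x.2.1, x.1 + x.2.2), ⟨(x.1, x.2.2), by simp⟩⟩
      left_inv := by
        rintro ⟨⟨d, k⟩, ⟨⟨s, r⟩, h⟩⟩
        obtain rfl : s + r = k := HasAntidiagonal.mem_antidiagonal.1 h
        rfl
      right_inv := fun _ => rfl }
  have h5 := (e.hasSum_iff.2 h2).sigma fun q => hasSum_fintype _
  refine (iff_of_eq ?_).mp h5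
  congr 1
  funext q
  exact sum_coe_sort (antidiagonal q.2) fun p => a ^ (p.1 + 1) * B ^ p.2
    * (depthSum (q.1 + 1) p.1 p.2 : ℂ) * Y ^ (q.1 + 2)

/-! ### Generating series of the zeta values. -/

lemma hasSum_riemannZeta {k : ℕ} (hk : 1 < k) :
    HasSum (fun i : ℕ => (((i : ℂ) + 1) ^ k)⁻¹) (riemannZeta k) := by
  have hs : Summable fun n : ℕ => 1 / (n : ℂ) ^ k := by
    have h := Complex.hasSum_ofReal.2 (Real.summable_one_div_nat_pow.2 hk).hasSum
    refine h.summable.congr fun n => ?_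
    push_cast
    rfl
  have h := (hasSum_nat_add_iff' 1).2 hs.hasSum
  rw [← zeta_nat_eq_tsum_of_gt_one hk] at h
  have h0 : (0 : ℂ) ^ k = 0 := zero_pow (by omega)
  simpa [h0] using h

lemma norm_lt_norm_natCast_add_one {B : ℂ} (hB : ‖B‖ < 1) (j : ℕ) : ‖B‖ < ‖(j : ℂ) + 1‖ := by
  rw [norm_natCast_add_one]
  linarith [(Nat.cast_nonneg j : (0 : ℝ) ≤ j)]

lemma summable_inv_mul_inv {B Y : ℂ} (hB : ‖B‖ < 1) (hY : ‖Y‖ < 1) :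
    Summable fun i : ℕ => ((i : ℂ) + 1 - Y)⁻¹ * ((i : ℂ) + 1 - B)⁻¹ :=
  (hasSum_inv_mul_inv hY hB).summable.congr fun _ => mul_inv _ _

/-- The joint family behind the generating series of the values `ζ(d + k + 2)`. -/
noncomputable def zetaTerm (B Y : ℂ) (q : ℕ × (ℕ × ℕ)) : ℂ :=
  (((q.1 : ℂ) + 1) ^ (q.2.1 + 1))⁻¹ * Y ^ q.2.1 * ((((q.1 : ℂ) + 1) ^ (q.2.2 + 1))⁻¹ * B ^ q.2.2)

lemma hasSum_zetaTerm_fiber {B Y : ℂ} (hB : ‖B‖ < 1) (hY : ‖Y‖ < 1) (i : ℕ) :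
    HasSum (fun q => zetaTerm B Y (i, q)) (((i : ℂ) + 1 - Y)⁻¹ * ((i : ℂ) + 1 - B)⁻¹) := by
  have h := hasSum_mul_prod (hasSum_geom_inv (norm_lt_norm_natCast_add_one hY i))
    (hasSum_geom_inv (norm_lt_norm_natCast_add_one hB i))
  simp only [zetaTerm]
  exact h

lemma zetaTerm_norm (B Y : ℂ) (q : ℕ × (ℕ × ℕ)) : ‖zetaTerm B Y q‖ = (zetaTerm ‖B‖ ‖Y‖ q).re := by
  have : zetaTerm ‖B‖ ‖Y‖ q = ((‖zetaTerm B Y q‖ : ℝ) : ℂ) := by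
    simp only [zetaTerm, norm_mul, norm_inv, norm_pow, norm_natCast_add_one]
    push_cast
    rfl
  rw [this, Complex.ofReal_re]

lemma summable_zetaTerm {B Y : ℂ} (hB : ‖B‖ < 1) (hY : ‖Y‖ < 1) :
    Summable fun q => ‖zetaTerm B Y q‖ := by
  have hB' : ‖((‖B‖ : ℝ) : ℂ)‖ < 1 := by simpa using hB
  have hY' : ‖((‖Y‖ : ℝ) : ℂ)‖ < 1 := by simpa using hY
  have hfib' : ∀ i : ℕ, HasSum (fun q => ‖zetaTerm B Y (i, q)‖)
      (((i : ℂ) + 1 - ‖Y‖)⁻¹ * ((i : ℂ) + 1 - ‖B‖)⁻¹).re := fun i => by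
    simp only [zetaTerm_norm B Y]
    exact Complex.reCLM.hasSum (hasSum_zetaTerm_fiber hB' hY' i)
  refine (summable_prod_of_nonneg fun _ => norm_nonneg _).2 ⟨fun i => (hfib' i).summable, ?_⟩
  simp only [(hfib' _).tsum_eq]
  exact Complex.reCLM.summable (summable_inv_mul_inv hB' hY')

lemma hasSum_zeta_double {B Y : ℂ} (hB : ‖B‖ < 1) (hY : ‖Y‖ < 1) :
    HasSum (fun q : ℕ × ℕ => riemannZeta ((q.1 + q.2 + 2 : ℕ) : ℂ) * (B ^ (q.2 + 1) * Y ^ (q.1 + 1)))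
      (B * Y * ∑' i : ℕ, pochRatio B Y i * (((i : ℂ) + 1) * ((i : ℂ) + 1 - B))⁻¹) := by
  have hs := summable_zetaTerm hB hY
  have hV : HasSum (fun i : ℕ => ((i : ℂ) + 1 - Y)⁻¹ * ((i : ℂ) + 1 - B)⁻¹)
      (∑' i : ℕ, pochRatio B Y i * (((i : ℂ) + 1) * ((i : ℂ) + 1 - B))⁻¹) := by
    have h := hasSum_inv_mul_inv hB hY
    simpa only [mul_inv, mul_comm (_ - B)⁻¹] using h
  have h0 : HasSum (zetaTerm B Y) (∑' i : ℕ, pochRatio B Y i * (((i : ℂ) + 1) * ((i : ℂ) + 1 - B))⁻¹) := by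
    rw [← (hs.of_norm.hasSum.prod_fiberwise (hasSum_zetaTerm_fiber hB hY)).unique hV]
    exact hs.of_norm.hasSum
  have h1 := (Equiv.prodComm (ℕ × ℕ) ℕ).hasSum_iff.2 (h0.mul_left (B * Y))
  refine h1.prod_fiberwise fun q => ?_
  refine (iff_of_eq ?_).mp ((hasSum_riemannZeta (k := q.1 + q.2 + 2) (by omega)).mul_right
    (B ^ (q.2 + 1) * Y ^ (q.1 + 1)))
  congr 1
  funext i
  simp only [Function.comp, Equiv.prodComm_apply, Prod.swap, zetaTerm]
  rw [show q.1 + q.2 + 2 = (q.1 + 1) + (q.2 + 1) by ring, pow_add, mul_inv]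
  ring

/-! ### Assembling the Gamma identity. -/

/-- The generating terms of the weighted sums, with the depth-one terms removed. -/
noncomputable def weightedTerm (a B Y : ℂ) (q : ℕ × ℕ) : ℂ :=
  if q.1 = 0 then 0 else
    ∑ p ∈ antidiagonal q.2, a ^ (p.1 + 1) * B ^ p.2 * (depthSum q.1 p.1 p.2 : ℂ) * Y ^ (q.1 + 1)

lemma hasSum_weightedTerm {a B Y : ℂ} (ha : ‖a‖ < 2) (hB : ‖B‖ < 1) (hY : ‖Y‖ < 1) {V : ℂ}
    (hV : HasSum (fun M : ℕ => a * (((M : ℂ) + 2) * ((M : ℂ) + 2 - a))⁻¹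
      * (Y * (pochRatio B Y (M + 1) - 1))) V) :
    HasSum (weightedTerm a B Y) V := by
  have hinj : Function.Injective fun q : ℕ × ℕ => (q.1 + 1, q.2) := fun p q h => by
    simp only [Prod.mk.injEq, add_left_inj] at h
    exact Prod.ext h.1 h.2
  refine (hinj.hasSum_iff fun q hq => ?_).1 (hasSum_weighted ha hB hY hV)
  rcases q with ⟨_ | d, k⟩
  · simp [weightedTerm]
  · exact absurd ⟨(d, k), rfl⟩ hq

lemma weightedSumMZV_mul (d k : ℕ) (u v X Y : ℂ) :
    weightedSumMZV (d + 1 + k + 2) (d + 1 + 1) u v * X ^ (k + 1) * Y ^ (d + 1 + 1)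
      = weightedTerm (u * X) (v * X) Y (d + 1, k) := by
  rw [weightedSumMZV_eq, weightedTerm, if_neg (Nat.succ_ne_zero d), sum_mul, sum_mul]
  refine sum_congr rfl fun p hp => ?_
  simp only at hp ⊢
  rw [← HasAntidiagonal.mem_antidiagonal.1 hp, mul_pow, mul_pow]
  ring

lemma summable_weighted_aux {a B Y : ℂ} (ha : ‖a‖ < 2) (hB : ‖B‖ < 1) (hY : ‖Y‖ < 1) :
    Summable fun M : ℕ => a * (((M : ℂ) + 2) * ((M : ℂ) + 2 - a))⁻¹
      * (Y * (pochRatio B Y (M + 1) - 1)) := by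
  obtain ⟨K, -, hK⟩ := norm_add_two_mul_inv_le ha
  have hs1 := (summable_norm_pochRatio_succ_mul hB hY hK).of_norm
  have hs2 := (summable_norm_pochRatio_succ_mul (B := 0) (Y := 0) (by simp) (by simp) hK).of_norm
  refine ((hs1.sub hs2).mul_left (a * Y)).congr fun M => ?_
  simp only [pochRatio, zero_div, add_zero, prod_const_one]
  ring

lemma tsum_pochRatio_eq_zero_add {B Y : ℂ} (hB : ‖B‖ < 1) (hY : ‖Y‖ < 1) :
    Summable (fun i : ℕ => pochRatio B Y (i + 1) * (((i : ℂ) + 2) * ((i : ℂ) + 2 - B))⁻¹) ∧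
    ∑' i : ℕ, pochRatio B Y i * (((i : ℂ) + 1) * ((i : ℂ) + 1 - B))⁻¹
      = (1 - B)⁻¹ + ∑' i : ℕ, pochRatio B Y (i + 1) * (((i : ℂ) + 2) * ((i : ℂ) + 2 - B))⁻¹ := by
  have hs := (summable_norm_pochRatio_mul hB hY fun i =>
    norm_inv_mul_inv_le (norm_inv_natCast_add_one i).le (norm_inv_natCast_add_one_sub_le hB i)).of_norm
  have e : ∀ i : ℕ, (((i + 1 : ℕ) : ℂ) + 1) = (i : ℂ) + 2 := fun i => by push_cast; ring
  constructor
  · have := (summable_nat_add_iff 1).2 hs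
    simpa only [e] using this
  · rw [hs.tsum_eq_zero_add]
    simp only [e]
    simp

/-- With m = i + 2, the coefficient of Y P_{m-1}(B, Y) is 1/(m - A - B) - 1/(m - B) = A/((m - A -
B)(m - B)), as in `connTerm` at N = 0, and symmetrically for A. The two -1 parts cancel, and the
split-off terms at i = 0 give the rational correction in `connSum`. -/
lemma tsum_add_tsum_sub_eq {A B Y : ℂ} (hA : ‖A‖ < 1) (hB : ‖B‖ < 1) (hY : ‖Y‖ < 1) :
    (∑' M : ℕ, (A + B) * (((M : ℂ) + 2) * ((M : ℂ) + 2 - (A + B)))⁻¹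
        * (Y * (pochRatio B Y (M + 1) - 1)))
      + (∑' M : ℕ, (A + B) * (((M : ℂ) + 2) * ((M : ℂ) + 2 - (A + B)))⁻¹
        * (-Y * (pochRatio A (-Y) (M + 1) - 1)))
      - (B * Y * ∑' i : ℕ, pochRatio B Y i * (((i : ℂ) + 1) * ((i : ℂ) + 1 - B))⁻¹)
      - (A * -Y * ∑' i : ℕ, pochRatio A (-Y) i * (((i : ℂ) + 1) * ((i : ℂ) + 1 - A))⁻¹)
      = 1 - connSum A B Y 0 := by
  have hY' : ‖-Y‖ < 1 := by simpa using hY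
  have ha : ‖A + B‖ < 2 := (norm_add_le A B).trans_lt (by linarith)
  obtain ⟨s1, e1⟩ := tsum_pochRatio_eq_zero_add hB hY
  obtain ⟨s2, e2⟩ := tsum_pochRatio_eq_zero_add hA hY'
  have s3 := summable_weighted_aux ha hB hY
  have s4 := summable_weighted_aux ha hA hY'
  have s5 := (summable_connTerm hA hB hY 0).hasSum.mul_left Y
  have s6 := (summable_connTerm hB hA hY' 0).hasSum.mul_left Y
  have h1 := ((s3.hasSum.add s4.hasSum).sub (s1.hasSum.mul_left (B * Y))).sub
    (s2.hasSum.mul_left (A * -Y))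
  have h2 := h1.unique (a₂ := Y * (∑' n : ℕ, connTerm A B Y 0 n) - Y * ∑' n : ℕ, connTerm B A (-Y) 0 n) <| by
    refine (iff_of_eq ?_).mp (s5.sub s6)
    congr 1
    funext i
    have n1 := add_two_sub_ne_zero hA i
    have n2 := add_two_sub_ne_zero hB i
    have n3 := add_two_add_sub_ne_zero hA hB 0 i
    have n4 : (i : ℂ) + 2 ≠ 0 := by exact_mod_cast (by omega : i + 2 ≠ 0)
    simp only [connTerm, Nat.cast_zero, add_zero, sub_zero] at *
    rw [show (i : ℂ) + 2 - B - A = i + 2 - A - B by ring,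
      show (i : ℂ) + 2 - (A + B) = i + 2 - A - B by ring]
    generalize pochRatio B Y (i + 1) = p
    generalize pochRatio A (-Y) (i + 1) = q
    field_simp
    ring
  rw [e1, e2, connSum, connSeries, connSeries]
  have n1 : (1 : ℂ) - A ≠ 0 := by simpa using natCast_add_one_sub_ne_zero hA 0
  have n2 : (1 : ℂ) - B ≠ 0 := by simpa using natCast_add_one_sub_ne_zero hB 0
  have h3 : Y * (A - B) * ((1 - A) * (1 - B))⁻¹ = A * Y * (1 - A)⁻¹ - B * Y * (1 - B)⁻¹ := by
    field_simp
    ring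
  simp only [pochRatio_zero, Nat.cast_zero, zero_add, add_zero, one_mul, h3]
  linear_combination h2

/-- The pairs `(d, k)` parametrise the weights `l = d + k + 2` and depths `n = d + 1`. -/
def weightDepthEquiv : ℕ × ℕ ≃ {p : ℕ × ℕ // 1 ≤ p.2 ∧ p.2 < p.1} where
  toFun q := ⟨(q.1 + q.2 + 2, q.1 + 1), Nat.succ_pos _, by dsimp only; omega⟩
  invFun p := (p.1.2 - 1, p.1.1 - p.1.2 - 1)
  left_inv q := by
    ext <;> simp
    omega
  right_inv p := by
    obtain ⟨⟨l, n⟩, h1, h2⟩ := p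
    simp only at h1 h2
    ext <;> simp <;> omega

lemma hasSum_weightedSumMZV {x y X Y : ℂ} (hx : ‖x * X‖ < 1) (hy : ‖y * X‖ < 1) (hY : ‖Y‖ < 1) :
    HasSum
      (fun p : {p : ℕ × ℕ // 1 ≤ p.2 ∧ p.2 < p.1} =>
        (weightedSumMZV p.1.1 p.1.2 (x + y) y
            + (-1) ^ p.1.2 * weightedSumMZV p.1.1 p.1.2 (y + x) x
            - ((-1) ^ p.1.2 * x ^ (p.1.1 - p.1.2) + y ^ (p.1.1 - p.1.2))
              * riemannZeta (p.1.1 : ℂ))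
          * X ^ (p.1.1 - p.1.2) * Y ^ p.1.2)
      (1 - gammaRatio (x * X) (-Y) * gammaRatio (y * X) Y) := by
  have hY' : ‖-Y‖ < 1 := by simpa using hY
  have ha : ‖x * X + y * X‖ < 2 := (norm_add_le _ _).trans_lt (by linarith)
  rw [← connSum_zero_eq hx hy hY, ← tsum_add_tsum_sub_eq hx hy hY, ← weightDepthEquiv.hasSum_iff]
  refine (iff_of_eq ?_).mp ((((hasSum_weightedTerm ha hy hY (summable_weighted_aux ha hy hY).hasSum).add
    (hasSum_weightedTerm ha hx hY' (summable_weighted_aux ha hx hY').hasSum)).sub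
    (hasSum_zeta_double hy hY)).sub (hasSum_zeta_double hx hY'))
  congr 1
  funext ⟨d, k⟩
  simp only [Function.comp, weightDepthEquiv, Equiv.coe_fn_mk]
  rw [show d + k + 2 - (d + 1) = k + 1 by omega, ← add_mul, neg_pow Y, mul_pow, mul_pow]
  -- In depth one the two weighted sums cancel; otherwise both are values of `weightedTerm`.
  rcases d with _ | d
  · rw [weightedSumMZV_one k (x + y) y x, add_comm y x]
    simp only [weightedTerm, if_true]
    ring
  · have h1 := weightedSumMZV_mul d k (x + y) y X Y
    have h2 := weightedSumMZV_mul d k (x + y) x X (-Y)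
    rw [neg_pow Y] at h2
    rw [← h1, ← h2, add_comm y x]
    ring

lemma gammaRatio_mul (A B Y : ℂ) :
    gammaRatio A (-Y) * gammaRatio B Y = Complex.Gamma (1 - A) * Complex.Gamma (1 - Y)
            * Complex.Gamma (1 - B) * Complex.Gamma (1 + Y)
          / (Complex.Gamma (1 - A - Y) * Complex.Gamma (1 - B + Y)) := by
  rw [gammaRatio, gammaRatio, div_mul_div_comm, ← sub_eq_add_neg, ← sub_eq_add_neg]
  ring

/-! ### The exponential form. -/

/-- The Taylor series of `log Γ(1 - z)` without its linear term. -/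
noncomputable def logGammaSeries (z : ℂ) : ℂ :=
  ∑' k : ℕ, riemannZeta ((k + 2 : ℕ) : ℂ) * (z ^ (k + 2) / ((k + 2 : ℕ) : ℂ))

lemma hasSum_logGammaSeries {z : ℂ} (hz : ‖z‖ < 1) :
    HasSum (fun k : ℕ => riemannZeta ((k + 2 : ℕ) : ℂ) * (z ^ (k + 2) / ((k + 2 : ℕ) : ℂ)))
        (logGammaSeries z) ∧
      HasSum (fun i : ℕ => -Complex.log (1 - z / ((i : ℂ) + 1)) - z / ((i : ℂ) + 1))
        (logGammaSeries z) := by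
  let f : ℕ × ℕ → ℂ := fun q => (z / ((q.1 : ℂ) + 1)) ^ (q.2 + 2) / ((q.2 + 2 : ℕ) : ℂ)
  have hs : Summable f := by
    have h1 := (summable_rpow_div_sq (σ := 0) (by norm_num)).mul_of_nonneg
      ((summable_nat_add_iff 2).2 (summable_geometric_of_lt_one (norm_nonneg z) hz))
      (fun i => by positivity) (fun i => by positivity)
    refine Summable.of_norm_bounded h1 fun q => ?_
    simp only [f, norm_div, norm_pow, norm_natCast_add_one, Complex.norm_natCast, Real.rpow_zero]
    have h2 : (1 : ℝ) ≤ ((q.2 + 2 : ℕ) : ℝ) := by exact_mod_cast (by omega : 1 ≤ q.2 + 2)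
    have h3 : (1 : ℝ) ≤ (q.1 : ℝ) + 1 := by linarith [(Nat.cast_nonneg q.1 : (0 : ℝ) ≤ q.1)]
    calc _ ≤ (‖z‖ / ((q.1 : ℝ) + 1)) ^ (q.2 + 2) := div_le_self (by positivity) h2
      _ = 1 / ((q.1 : ℝ) + 1) ^ (q.2 + 2) * ‖z‖ ^ (q.2 + 2) := by rw [div_pow]; ring
      _ ≤ 1 / ((q.1 : ℝ) + 1) ^ 2 * ‖z‖ ^ (q.2 + 2) := by
          gcongr
          omega
  have hfib1 : ∀ i : ℕ, HasSum (fun k => f (i, k))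
      (-Complex.log (1 - z / ((i : ℂ) + 1)) - z / ((i : ℂ) + 1)) := fun i => by
    have h1 : ‖z / ((i : ℂ) + 1)‖ < 1 := by
      have h2 := norm_lt_norm_natCast_add_one hz i
      rwa [norm_div, div_lt_one ((norm_nonneg z).trans_lt h2)]
    have h2 := (hasSum_nat_add_iff' 2).2 (Complex.hasSum_taylorSeries_neg_log h1)
    simpa [sum_range_succ, f] using h2
  have h1 := (Equiv.prodComm ℕ ℕ).hasSum_iff.2 hs.hasSum
  have h2 := h1.prod_fiberwise
    (g := fun k : ℕ => riemannZeta ((k + 2 : ℕ) : ℂ) * (z ^ (k + 2) / ((k + 2 : ℕ) : ℂ))) fun k => by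
      refine (iff_of_eq ?_).mp ((hasSum_riemannZeta (k := k + 2) (by omega)).mul_right
        (z ^ (k + 2) / ((k + 2 : ℕ) : ℂ)))
      congr 1
      funext i
      simp only [Function.comp, Equiv.prodComm_apply, Prod.swap, f, div_pow]
      ring
  refine ⟨h2.summable.hasSum, ?_⟩
  rw [logGammaSeries, h2.tsum_eq]
  exact hs.hasSum.prod_fiberwise hfib1

lemma exp_neg_log_sub {z : ℂ} (hz : ‖z‖ < 1) (i : ℕ) :
    Complex.exp (-Complex.log (1 - z / ((i : ℂ) + 1)) - z / ((i : ℂ) + 1))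
      = ((i : ℂ) + 1) / ((i : ℂ) + 1 - z) * Complex.exp (-(z / ((i : ℂ) + 1))) := by
  have h1 := natCast_add_one_sub_ne_zero hz i
  have h2 : (i : ℂ) + 1 ≠ 0 := Nat.cast_add_one_ne_zero i
  have h3 : 1 - z / ((i : ℂ) + 1) = ((i : ℂ) + 1 - z) / ((i : ℂ) + 1) := by field_simp
  rw [sub_eq_add_neg, Complex.exp_add, Complex.exp_neg, Complex.exp_log, h3, inv_div]
  rw [h3]
  exact div_ne_zero h1 h2

/-- Exponentiating partial sums avoids any branch of log Γ. The factors exp(-z/(i + 1)) cancel since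
A + B + Y - Y = (A + Y) + (B - Y), leaving the finite products of `tendsto_pochRatio_div`. -/
lemma exp_logGammaSeries {A B Y : ℂ} (hA : ‖A‖ < 1) (hB : ‖B‖ < 1) (hY : ‖Y‖ < 1)
    (hAY : ‖A + Y‖ < 1) (hBY : ‖B - Y‖ < 1) :
    Complex.exp (logGammaSeries A + logGammaSeries B + logGammaSeries Y + logGammaSeries (-Y)
        - logGammaSeries (A + Y) - logGammaSeries (B - Y))
      = gammaRatio A (-Y) * gammaRatio B Y := by
  have hY' : ‖-Y‖ < 1 := by simpa using hY
  have h1 := ((((((hasSum_logGammaSeries hA).2.add (hasSum_logGammaSeries hB).2).add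
    (hasSum_logGammaSeries hY).2).add (hasSum_logGammaSeries hY').2).sub
    (hasSum_logGammaSeries hAY).2).sub (hasSum_logGammaSeries hBY).2).tendsto_sum_nat
  have h2 := (Complex.continuous_exp.tendsto _).comp h1
  refine tendsto_nhds_unique h2 (((tendsto_pochRatio_div hA (-Y)).mul
    (tendsto_pochRatio_div hB Y)).congr fun N => ?_)
  simp only [Function.comp, Complex.exp_sum, pochRatio]
  rw [← prod_div_distrib, ← prod_div_distrib, ← prod_mul_distrib]
  refine prod_congr rfl fun i _ => ?_
  rw [Complex.exp_sub, Complex.exp_sub, Complex.exp_add, Complex.exp_add, Complex.exp_add,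
    exp_neg_log_sub hA, exp_neg_log_sub hB, exp_neg_log_sub hY, exp_neg_log_sub hY',
    exp_neg_log_sub hAY, exp_neg_log_sub hBY]
  have n0 : (i : ℂ) + 1 ≠ 0 := Nat.cast_add_one_ne_zero i
  have n1 := natCast_add_one_sub_ne_zero hA i
  have n2 := natCast_add_one_sub_ne_zero hB i
  have n3 := natCast_add_one_sub_ne_zero hY i
  have n4 := natCast_add_one_sub_ne_zero hY' i
  have n5 := natCast_add_one_sub_ne_zero hAY i
  have n6 := natCast_add_one_sub_ne_zero hBY i
  have e1 : Complex.exp (-((A + Y) / ((i : ℂ) + 1)))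
      = Complex.exp (-(A / ((i : ℂ) + 1))) * Complex.exp (-(Y / ((i : ℂ) + 1))) := by
    rw [← Complex.exp_add]; congr 1; ring
  have e2 : Complex.exp (-((B - Y) / ((i : ℂ) + 1)))
      = Complex.exp (-(B / ((i : ℂ) + 1))) * Complex.exp (-(-Y / ((i : ℂ) + 1))) := by
    rw [← Complex.exp_add]; congr 1; ring
  rw [e1, e2]
  have m1 := Complex.exp_ne_zero (-(A / ((i : ℂ) + 1)))
  have m2 := Complex.exp_ne_zero (-(B / ((i : ℂ) + 1)))
  have m3 := Complex.exp_ne_zero (-(Y / ((i : ℂ) + 1)))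
  have m4 := Complex.exp_ne_zero (-(-Y / ((i : ℂ) + 1)))
  generalize Complex.exp (-(A / ((i : ℂ) + 1))) = E1 at *
  generalize Complex.exp (-(B / ((i : ℂ) + 1))) = E2 at *
  generalize Complex.exp (-(Y / ((i : ℂ) + 1))) = E3 at *
  generalize Complex.exp (-(-Y / ((i : ℂ) + 1))) = E4 at *
  generalize (i : ℂ) + 1 = z at *
  rw [sub_zero, one_add_div n0, one_add_div n0, one_add_div n1, one_add_div n2]
  rw [sub_neg_eq_add] at n4 ⊢
  have c1 : z - A + -Y = z - (A + Y) := by ring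
  have c2 : z - B + Y = z - (B - Y) := by ring
  rw [c1, c2, ← sub_eq_add_neg]
  field_simp

/-- The shift by two as an equivalence. -/
def natAddTwoEquiv : ℕ ≃ {m : ℕ // 2 ≤ m} where
  toFun k := ⟨k + 2, by omega⟩
  invFun m := m.1 - 2
  left_inv k := by simp
  right_inv m := by
    obtain ⟨m, hm⟩ := m
    ext
    simp
    omega

lemma hasSum_log_series {x y X Y : ℂ} (hx : ‖x * X‖ < 1) (hy : ‖y * X‖ < 1) (hY : ‖Y‖ < 1)
    (hxY : ‖x * X + Y‖ < 1) (hyY : ‖y * X - Y‖ < 1) :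
    HasSum (fun m : {m : ℕ // 2 ≤ m} =>
        riemannZeta (m.1 : ℂ)
          * (((x ^ m.1 + y ^ m.1) * X ^ m.1 + (1 + (-1) ^ m.1) * Y ^ m.1
              - (x * X + Y) ^ m.1 - (y * X - Y) ^ m.1) / (m.1 : ℂ)))
      (logGammaSeries (x * X) + logGammaSeries (y * X) + logGammaSeries Y + logGammaSeries (-Y)
        - logGammaSeries (x * X + Y) - logGammaSeries (y * X - Y)) := by
  have hY' : ‖-Y‖ < 1 := by simpa using hY
  rw [← natAddTwoEquiv.hasSum_iff]
  refine (iff_of_eq ?_).mp ((((((hasSum_logGammaSeries hx).1.add (hasSum_logGammaSeries hy).1).add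
    (hasSum_logGammaSeries hY).1).add (hasSum_logGammaSeries hY').1).sub
    (hasSum_logGammaSeries hxY).1).sub (hasSum_logGammaSeries hyY).1)
  congr 1
  funext k
  simp only [Function.comp, natAddTwoEquiv, Equiv.coe_fn_mk]
  rw [mul_pow, mul_pow, neg_pow Y]
  ring

/-- `HasSum` and `Summable` in ℂ mean unconditional, hence absolute, convergence. The default values
Γ = 0 at poles and z / 0 = 0 agree with reading 1/Γ as an entire function. -/
theorem theorem1 (x y X Y : ℂ) (hx : ‖x * X‖ < 1) (hy : ‖y * X‖ < 1) (hY : ‖Y‖ < 1) :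
    HasSum
      (fun p : {p : ℕ × ℕ // 1 ≤ p.2 ∧ p.2 < p.1} =>
        (weightedSumMZV p.1.1 p.1.2 (x + y) y
            + (-1) ^ p.1.2 * weightedSumMZV p.1.1 p.1.2 (y + x) x
            - ((-1) ^ p.1.2 * x ^ (p.1.1 - p.1.2) + y ^ (p.1.1 - p.1.2))
              * riemannZeta (p.1.1 : ℂ))
          * X ^ (p.1.1 - p.1.2) * Y ^ p.1.2)
      (1 - Complex.Gamma (1 - x * X) * Complex.Gamma (1 - Y)
            * Complex.Gamma (1 - y * X) * Complex.Gamma (1 + Y)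
          / (Complex.Gamma (1 - x * X - Y) * Complex.Gamma (1 - y * X + Y))) ∧
    (‖x * X + Y‖ < 1 → ‖y * X - Y‖ < 1 →
      Summable (fun m : {m : ℕ // 2 ≤ m} =>
        riemannZeta (m.1 : ℂ)
          * (((x ^ m.1 + y ^ m.1) * X ^ m.1 + (1 + (-1) ^ m.1) * Y ^ m.1
              - (x * X + Y) ^ m.1 - (y * X - Y) ^ m.1) / (m.1 : ℂ))) ∧
      1 - Complex.Gamma (1 - x * X) * Complex.Gamma (1 - Y)
            * Complex.Gamma (1 - y * X) * Complex.Gamma (1 + Y)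
          / (Complex.Gamma (1 - x * X - Y) * Complex.Gamma (1 - y * X + Y))
        = 1 - Complex.exp (∑' m : {m : ℕ // 2 ≤ m},
            riemannZeta (m.1 : ℂ)
              * (((x ^ m.1 + y ^ m.1) * X ^ m.1 + (1 + (-1) ^ m.1) * Y ^ m.1
                  - (x * X + Y) ^ m.1 - (y * X - Y) ^ m.1) / (m.1 : ℂ)))) := by
  rw [← gammaRatio_mul]
  refine ⟨hasSum_weightedSumMZV hx hy hY, fun hxY hyY => ?_⟩
  have h := hasSum_log_series hx hy hY hxY hyY
  exact ⟨h.summable, by rw [h.tsum_eq, exp_logGammaSeries hx hy hY hxY hyY]⟩
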